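/- Let $\mathbb L^3(t,x,y)$ carry the metric $-dt^2+dx^2+dy^2$. Let $U\subset\mathbb R^2$ be an open set containing the origin $o$, and let $g:U\to\mathbb R$ be a real analytic solution of the zero mean curvature equation $$(1-g_y^2)g_{xx}+2g_xg_yg_{xy}+(1-g_x^2)g_{yy}=0$$ with $g(o)=0$, such that $B_g:=1-g_x^2-g_y^2$ satisfies $B_g(o)=0$ and $\nabla B_g(o)=0$. "Interval" means an open interval containing $0$. *Approximation function.* If a surface contains a segment $L=\{(s,0,s): s\in J\}$, with $J$ an interval, and is near $L$ a real analytic graph $t=f(x,y)=y+\frac{\alpha(y)}2x^2+O(x^3)$, then $\alpha(s)=f_{xx}(0,s)$, $s\in J$, is its approximation function along $L$. Its class is the one of the following functions to which $\alpha$ is equal on $J$ after a rescaling $\alpha(s)\mapsto k\,\alpha(ks)$, $k>0$ (induced by a homothety): $\alpha^+=-\tan(s+c)$, $|c|<\frac\pi2$; $\alpha^0_I=0$; $\alpha^0_{II}=(s+c)^{-1}$, $c\ne0$; $\alpha^-_I=\tanh(s+c)$; $\alpha^-_{II}=\coth(s+c)$, $c\neq 0$; $\alpha^-_{III}=\pm1$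 (no poles on $J$). *Wick rotations.* Extend the germ of $g$ at $o$ holomorphically (and along connected sets by analytic continuation). (i) Suppose $g$ is even in $x$, and put $h(\tilde t,\tilde x)=g(i\tilde x,\tilde t)$. For every interval $J$ with $\{0\}\times J\subset U$, there is a connected open neighbourhood of $J\times\{0\}$ on which $h$ exists and is real valued. On every connected open $V\ni o$ on which $h$ exists as a real valued function, it is a real analytic solution of the Born–Infeld equation $$(1-h_{\tilde t}^2)h_{\tilde x\tilde x}+2h_{\tilde t}h_{\tilde x}h_{\tilde t\tilde x}-(1+h_{\tilde x}^2)h_{\tilde t\tilde t}=0 .$$ There is a sign $\varepsilon=\pm1$ such that the graph $t=g(x,y)$ contains a lightlike segment $L\subset\{(\varepsilon y,0,y)\}$ and the graph $\tilde y=h(\tilde t,\tilde x)$ in $\mathbb L^3(\tilde t,\tilde x,\tilde y)$ contains a lightlike segment $\tilde L\subset\{(\varepsilon\tilde y,0,\tilde y)\}$. Let $a,b\in\{1,-1\}$ with $ab=\varepsilon$, and normalize both lines to $\{(s,0,s)\}$ by the corresponding reflections $(t,x,y)\mapsto(at,x,by)$ and $(\tilde t,\tilde x,\tilde y)\mapsto(b\tilde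 t,\tilde x,a\tilde y)$. Then both normalized graphs have approximation functions $\alpha_g$ and $\alpha_h$, on all intervals $J_g$ and $J_h$ whose segments on the axis of symmetry, $\{(0,bs):s\in J_g\}$ and $\{(bs,0):s\in J_h\}$, lie in $U$ and $V$ respectively; $\alpha_h=\alpha_g$ on $J_g\cap J_h$; and each belongs to exactly one of the six classes, the same for both. (ii) Suppose $g$ is odd in $x$, and put $h(\tilde t,\tilde x)=-ig(i\tilde t,\tilde x)$. Then $h$ exists as a real valued function on a connected open neighbourhood of $o$, and on every connected open $V\ni o$ on which $h$ exists as a real valued function it is a real analytic solution of the Born–Infeld equation. There is a sign $\varepsilon=\pm1$ such that the graph of $g$ contains a lightlike segment $L\subset\{(\varepsilon x,x,0)\}$ and the graph of $h$ contains a lightlike segment $\tilde L\subset\{(\varepsilon\tilde y,0,\tilde y)\}$. Normalize the lines as in (i), after exchanging the coordinates $x$ and $y$ for the graph of $g$. Then the normalized graphs have approximation functions $\alpha_g$ and $\alpha_h$, on all intervals $J_g$ and $J_h$ with $\{(bs,0):s\in J_g\}\subset U$ and $\{(bs,0):s\in J_h\}\subset V$; and $\alpha_h(s)=i\,\alpha_g(is)$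 on $J_h$, where $\alpha_g$ is extended holomorphically to an open set containing $J_g\cup iJ_h$. Both functions are odd: $\alpha(-s)=-\alpha(s)$ whenever $s$ and $-s$ lie in the interval. Each belongs to exactly one class, and the pair of classes of $(\alpha_g,\alpha_h)$ is $(\alpha^+,\alpha^-_I)$, $(\alpha^0_I,\alpha^0_I)$ or $(\alpha^-_I,\alpha^+)$. -/

import Mathlib

open Topology

/-- Partial derivative with respect to the first variable. -/
noncomputable def pd1 (f : ℝ × ℝ → ℝ) (p : ℝ × ℝ) : ℝ := fderiv ℝ f p (1, 0)

/-- Partial derivative with respect to the second variable. -/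
noncomputable def pd2 (f : ℝ × ℝ → ℝ) (p : ℝ × ℝ) : ℝ := fderiv ℝ f p (0, 1)

/-- The zero mean curvature equation
`(1 - g_y²) g_xx + 2 g_x g_y g_xy + (1 - g_x²) g_yy = 0` on `U`, for `g = g(x, y)`. -/
def SolvesZMC (g : ℝ × ℝ → ℝ) (U : Set (ℝ × ℝ)) : Prop :=
  ∀ p ∈ U, (1 - pd2 g p ^ 2) * pd1 (pd1 g) p + 2 * pd1 g p * pd2 g p * pd2 (pd1 g) p
    + (1 - pd1 g p ^ 2) * pd2 (pd2 g) p = 0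

/-- The Born-Infeld equation
`(1 - h_t²) h_xx + 2 h_t h_x h_tx - (1 + h_x²) h_tt = 0` on `V`, for `h = h(t, x)`. -/
def SolvesBornInfeld (h : ℝ × ℝ → ℝ) (V : Set (ℝ × ℝ)) : Prop :=
  ∀ p ∈ V, (1 - pd1 h p ^ 2) * pd2 (pd2 h) p + 2 * pd1 h p * pd2 h p * pd2 (pd1 h) p
    - (1 + pd2 h p ^ 2) * pd1 (pd1 h) p = 0

/-- `B_g = 1 - g_x² - g_y²`. The graph `t = g(x, y)` in Lorentz-Minkowski space is lightlike
exactly where `B_g` vanishes. -/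
noncomputable def causalB (g : ℝ × ℝ → ℝ) (p : ℝ × ℝ) : ℝ := 1 - pd1 g p ^ 2 - pd2 g p ^ 2

/-- `g` is even in its first variable (wherever both sides are defined). -/
def EvenInFirst (g : ℝ × ℝ → ℝ) (U : Set (ℝ × ℝ)) : Prop :=
  ∀ x y : ℝ, (x, y) ∈ U → (-x, y) ∈ U → g (-x, y) = g (x, y)

/-- `g` is odd in its first variable (wherever both sides are defined). -/
def OddInFirst (g : ℝ × ℝ → ℝ) (U : Set (ℝ × ℝ)) : Prop :=
  ∀ x y : ℝ, (x, y) ∈ U → (-x, y) ∈ U → g (-x, y) = -g (x, y)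

/-- `G`, on the open set `Ω ⊆ ℂ²`, is a holomorphic extension of the germ of `g` at the origin. -/
def IsHolomorphicExtension (g : ℝ × ℝ → ℝ) (Ω : Set (ℂ × ℂ)) (G : ℂ × ℂ → ℂ) : Prop :=
  IsOpen Ω ∧ (0, 0) ∈ Ω ∧ AnalyticOnNhd ℂ G Ω ∧
    ∀ᶠ p : ℝ × ℝ in 𝓝 (0, 0), G ((p.1 : ℂ), (p.2 : ℂ)) = (g p : ℂ)

/-- The real function `h = h(t, x)` on the domain `V ∋ 0` is the Wick rotation
`h(t, x) = g(i x, t)` of `g = g(x, y)`. As `V` is connected, the values of the holomorphic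
extension used here are the analytic continuation of `g` from the origin. -/
def IsWickRotationEven (g h : ℝ × ℝ → ℝ) (V : Set (ℝ × ℝ)) : Prop :=
  IsOpen V ∧ IsPreconnected V ∧ (0, 0) ∈ V ∧
    ∃ (Ω : Set (ℂ × ℂ)) (G : ℂ × ℂ → ℂ), IsHolomorphicExtension g Ω G ∧
      ∀ t x : ℝ, (t, x) ∈ V →
        (Complex.I * (x : ℂ), (t : ℂ)) ∈ Ω ∧
          (h (t, x) : ℂ) = G (Complex.I * (x : ℂ), (t : ℂ))

/-- The real function `h = h(t, x)` on the domain `V ∋ 0` is the Wick rotation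
`h(t, x) = -i g(i t, x)` of `g = g(x, y)`. -/
def IsWickRotationOdd (g h : ℝ × ℝ → ℝ) (V : Set (ℝ × ℝ)) : Prop :=
  IsOpen V ∧ IsPreconnected V ∧ (0, 0) ∈ V ∧
    ∃ (Ω : Set (ℂ × ℂ)) (G : ℂ × ℂ → ℂ), IsHolomorphicExtension g Ω G ∧
      ∀ t x : ℝ, (t, x) ∈ V →
        (Complex.I * (t : ℂ), (x : ℂ)) ∈ Ω ∧
          (h (t, x) : ℂ) = -Complex.I * G (Complex.I * (t : ℂ), (x : ℂ))

/-- The graph `t = g(x, y)`, `(x, y) ∈ U`, in Lorentz-Minkowski space with coordinates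
`(t, x, y)` and metric `-dt² + dx² + dy²`. -/
def graphOverXY (g : ℝ × ℝ → ℝ) (U : Set (ℝ × ℝ)) : Set (ℝ × ℝ × ℝ) :=
  {p | (p.2.1, p.2.2) ∈ U ∧ p.1 = g (p.2.1, p.2.2)}

/-- The graph `y = h(t, x)`, `(t, x) ∈ V`, in Lorentz-Minkowski space with coordinates
`(t, x, y)`. -/
def graphOverTX (h : ℝ × ℝ → ℝ) (V : Set (ℝ × ℝ)) : Set (ℝ × ℝ × ℝ) :=
  {p | (p.1, p.2.1) ∈ V ∧ p.2.2 = h (p.1, p.2.1)}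

/-- The image of `S` under the linear isometry `(t, x, y) ↦ (a t, x, b y)`, for signs `a, b`. -/
def reflectTY (a b : ℝ) (S : Set (ℝ × ℝ × ℝ)) : Set (ℝ × ℝ × ℝ) :=
  {p | (a * p.1, p.2.1, b * p.2.2) ∈ S}

/-- The image of `S` under the linear isometry `(t, x, y) ↦ (t, y, x)`. -/
def swapXY (S : Set (ℝ × ℝ × ℝ)) : Set (ℝ × ℝ × ℝ) :=
  {p | (p.1, p.2.2, p.2.1) ∈ S}

/-- An open interval of the real line (possibly unbounded) that contains `0`. -/
def IsOpenIntervalAtZero (J : Set ℝ) : Prop := IsOpen J ∧ J.OrdConnected ∧ (0 : ℝ) ∈ J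

/-- The surface `S` contains the lightlike segment `L = {(s, 0, s) : s ∈ J}`, is near `L` the graph
`t = f(x, y) = y + (α(y)/2) x² + O(x³)` of a real analytic function, and `α` is its approximation
function along `L`, that is, `α(s) = f_xx(0, s)`. The local function `f` is determined by `S`,
so `α` is determined on `J`. -/
def HasApproximationFunction (S : Set (ℝ × ℝ × ℝ)) (J : Set ℝ) (α : ℝ → ℝ) : Prop :=
  ∀ s ∈ J, (s, 0, s) ∈ S ∧
    ∃ f : ℝ × ℝ → ℝ, AnalyticAt ℝ f (0, s) ∧
      (∀ᶠ p : ℝ × ℝ × ℝ in 𝓝 (s, 0, s), p ∈ S ↔ p.1 = f (p.2.1, p.2.2)) ∧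
      pd1 f (0, s) = 0 ∧ α s = pd1 (pd1 f) (0, s)

/-- The six classes of zero mean curvature surfaces along a lightlike line:
`α⁺`, `α⁰_I`, `α⁰_II`, `α⁻_I`, `α⁻_II`, `α⁻_III`. -/
inductive LightlikeLineClass : Type
  | plus | zeroI | zeroII | minusI | minusII | minusIII

/-- On `J`, the function `α` is, up to the rescaling `α ↦ k α(k ·)`, `k > 0`, that a homothety of
the surface induces, the explicit solution of `α' + α² + μ = 0`, `μ ∈ {1, 0, -1}`, that names the
class, and has no pole on `J`. -/
def IsOfClass (J : Set ℝ) (α : ℝ → ℝ) : LightlikeLineClass → Prop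
  | .plus => ∃ k > 0, ∃ c : ℝ, |c| < Real.pi / 2 ∧
      ∀ s ∈ J, |k * s + c| < Real.pi / 2 ∧ α s = k * (-Real.tan (k * s + c))
  | .zeroI => ∀ s ∈ J, α s = 0
  | .zeroII => ∃ c : ℝ, c ≠ 0 ∧ ∀ s ∈ J, s + c ≠ 0 ∧ α s = (s + c)⁻¹
  | .minusI => ∃ k > 0, ∃ c : ℝ, ∀ s ∈ J, α s = k * Real.tanh (k * s + c)
  | .minusII => ∃ k > 0, ∃ c : ℝ, c ≠ 0 ∧
      ∀ s ∈ J, k * s + c ≠ 0 ∧ α s = k * (Real.cosh (k * s + c) / Real.sinh (k * s + c))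
  | .minusIII => ∃ k > 0, (∀ s ∈ J, α s = k) ∨ (∀ s ∈ J, α s = -k)

/-- On `J`, the function `α` belongs to the class `T` and to no other class. -/
def HasExactClass (J : Set ℝ) (α : ℝ → ℝ) (T : LightlikeLineClass) : Prop :=
  ∀ T' : LightlikeLineClass, IsOfClass J α T' ↔ T' = T

/-- `β(s) = i α(i s)` for `s ∈ J'`, where `α`, given on `J`, is extended holomorphically to an open
set that contains `J` and `i J'`. -/
def IsImaginaryRotation (J : Set ℝ) (α : ℝ → ℝ) (J' : Set ℝ) (β : ℝ → ℝ) : Prop :=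
  ∃ (D : Set ℂ) (A : ℂ → ℂ), IsOpen D ∧ AnalyticOnNhd ℂ A D ∧
    (∀ s ∈ J, (s : ℂ) ∈ D ∧ A (s : ℂ) = (α s : ℂ)) ∧
    ∀ s ∈ J', Complex.I * (s : ℂ) ∈ D ∧ (β s : ℂ) = Complex.I * A (Complex.I * (s : ℂ))

/-! Both parities lead to one situation. If `g` is even in `x`, then `g_x(o) = 0`; if it is odd,
then `g_y(o) = 0`, and `k(x, y) = g(y, x)` takes the place of `g`. So let `k_x(o) = 0`. Then `B = 0`
gives `k_y(o) = ε = ±1`, and `B_x = 0` gives `k_xy(o) = 0`. On the axis `x = 0` the functions `k_y -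
ε`, `k_x`, `k_xy` satisfy a homogeneous linear system of ODEs, read off from the equation and its
`x`-derivative. Hence they vanish, and the graph contains a lightlike segment
(`zmc_contains_lightlike_line`). A second `x`-derivative shows that `k_xxy + ε k_xx²` is constant
there (`zmc_riccati`). For the normalized graph this is a Riccati equation `α' + α² = D`.

Solutions of that equation are logarithmic derivatives `P'/P` with `P'' = D P`, so `α(0)` and `D`
alone determine the class, on every interval (`hasExactClass_of_riccati`).

Both Wick rotations have the form `h(t, x) = c k(lam x, mu t)` with `c mu = 1` and `(c lam)² = -1`:
the constants `(c, lam, mu)` are `(1, i, 1)` in the even case and `(-i, 1, i)` in the odd case.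
These two relations turn the zero mean curvature equation into the Born-Infeld equation and preserve
the line. If `A` is the holomorphic extension of `α_g`, then `α_h(s) = -c lam² A(mu s)`: this is
`α_g(s)` in the even case and `i α_g(i s)` in the odd case. The latter changes the sign of `D`, and
oddness forces `α(0) = 0`, which leaves three pairs of classes. That `h` can be chosen real follows
from parity combined with the conjugation symmetry of the extension. Identities are proved for germs
at `o` and propagated along intervals and connected domains by the identity theorem. -/

/-! ### Complexification of real analytic functions of two variables -/

/-- The inclusion of `ℝ²` into `ℂ²`. -/
noncomputable def realToComplexProd (q : ℝ × ℝ) : ℂ × ℂ := ((q.1 : ℂ), (q.2 : ℂ))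

theorem continuous_realToComplexProd : Continuous realToComplexProd := by
  unfold realToComplexProd; fun_prop

theorem dist_realToComplexProd (p q : ℝ × ℝ) :
    dist (realToComplexProd p) (realToComplexProd q) = dist p q := by
  simp only [realToComplexProd, Prod.dist_eq, Complex.dist_eq, Real.dist_eq, ← Complex.ofReal_sub,
    Complex.norm_real, Real.norm_eq_abs]

/-- Complex conjugation on `ℂ²`. -/
noncomputable def conjProd (z : ℂ × ℂ) : ℂ × ℂ := (starRingEnd ℂ z.1, starRingEnd ℂ z.2)

theorem continuous_conjProd : Continuous conjProd :=
  (Complex.continuous_conj.comp continuous_fst).prodMk (Complex.continuous_conj.comp continuous_snd)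

theorem conjProd_realToComplexProd (p : ℝ × ℝ) :
    conjProd (realToComplexProd p) = realToComplexProd p := by
  simp [conjProd, realToComplexProd]

/-- The base change to `ℂ` of a real multilinear form on `ℝ²`. -/
noncomputable def complexifyMultilinear {n : ℕ}
    (P : ContinuousMultilinearMap ℝ (fun _ : Fin n => ℝ × ℝ) ℝ) :
    ContinuousMultilinearMap ℂ (fun _ : Fin n => ℂ × ℂ) ℂ :=
  ∑ s : Finset (Fin n),
    ((P (fun i => if i ∈ s then ((1 : ℝ), (0 : ℝ)) else (0, 1)) : ℝ) : ℂ) •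
      (ContinuousMultilinearMap.mkPiAlgebraFin ℂ n ℂ).compContinuousLinearMap
        (fun i => if i ∈ s then ContinuousLinearMap.fst ℂ ℂ ℂ else ContinuousLinearMap.snd ℂ ℂ ℂ)

/-- There is one term for each of the `2 ^ n` subsets, and each has norm at most `‖P‖` because the
basis vectors and the coordinate projections have norm at most one. The factor costs half of the
radius of convergence. -/
theorem norm_complexifyMultilinear_le {n : ℕ}
    (P : ContinuousMultilinearMap ℝ (fun _ : Fin n => ℝ × ℝ) ℝ) :
    ‖complexifyMultilinear P‖ ≤ 2 ^ n * ‖P‖ := by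
  refine (norm_sum_le _ _).trans ?_
  have key : ∀ s ∈ (Finset.univ : Finset (Finset (Fin n))),
      ‖((P (fun i => if i ∈ s then ((1 : ℝ), (0 : ℝ)) else (0, 1)) : ℝ) : ℂ) •
        (ContinuousMultilinearMap.mkPiAlgebraFin ℂ n ℂ).compContinuousLinearMap
          (fun i => if i ∈ s then ContinuousLinearMap.fst ℂ ℂ ℂ
            else ContinuousLinearMap.snd ℂ ℂ ℂ)‖ ≤ ‖P‖ := by
    intro s _
    rw [norm_smul, Complex.norm_real]
    have h1 : ‖P (fun i => if i ∈ s then ((1 : ℝ), (0 : ℝ)) else (0, 1))‖ ≤ ‖P‖ := by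
      refine (P.le_opNorm_mul_prod_of_le fun i => ?_ :
        _ ≤ ‖P‖ * ∏ _i : Fin n, (1 : ℝ)).trans (by simp)
      split_ifs <;> simp [Prod.norm_def]
    have h2 : ‖(ContinuousMultilinearMap.mkPiAlgebraFin ℂ n ℂ).compContinuousLinearMap
          (fun i => if i ∈ s then ContinuousLinearMap.fst ℂ ℂ ℂ
            else ContinuousLinearMap.snd ℂ ℂ ℂ)‖ ≤ 1 := by
      refine (ContinuousMultilinearMap.norm_compContinuousLinearMap_le _ _).trans ?_
      rw [ContinuousMultilinearMap.norm_mkPiAlgebraFin, one_mul]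
      refine Finset.prod_le_one (fun _ _ => norm_nonneg _) fun i _ => ?_
      split_ifs
      · exact ContinuousLinearMap.norm_fst_le ℂ ℂ ℂ
      · exact ContinuousLinearMap.norm_snd_le ℂ ℂ ℂ
    calc _ ≤ ‖P‖ * 1 := mul_le_mul h1 h2 (norm_nonneg _) (norm_nonneg _)
      _ = ‖P‖ := mul_one _
  refine (Finset.sum_le_sum key).trans ?_
  simp

/-- Expand `v = (v.1, 0) + (0, v.2)` by multilinearity; the subset `s` records the slots that
receive the first summand. -/
theorem complexifyMultilinear_apply_real {n : ℕ}
    (P : ContinuousMultilinearMap ℝ (fun _ : Fin n => ℝ × ℝ) ℝ) (v : ℝ × ℝ) :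
    complexifyMultilinear P (fun _ => realToComplexProd v) = ((P (fun _ => v) : ℝ) : ℂ) := by
  have h1 : P (fun _ => v) = ∑ s : Finset (Fin n),
      (∏ i, if i ∈ s then v.1 else v.2) *
        P (fun i => if i ∈ s then ((1 : ℝ), (0 : ℝ)) else (0, 1)) := by
    have h2 : (fun _ : Fin n => v) = (fun _ => (v.1, (0 : ℝ))) + (fun _ => ((0 : ℝ), v.2)) := by
      funext i; simp
    rw [h2, ContinuousMultilinearMap.map_add_univ]
    refine Finset.sum_congr rfl fun s _ => ?_
    rw [← smul_eq_mul, ← ContinuousMultilinearMap.map_smul_univ]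
    congr 1
    funext i
    by_cases hi : i ∈ s <;> simp [hi]
  rw [h1]
  push_cast
  simp only [complexifyMultilinear, sum_apply,
    smul_apply, ContinuousMultilinearMap.compContinuousLinearMap_apply,
    ContinuousMultilinearMap.mkPiAlgebraFin_apply, smul_eq_mul, List.prod_ofFn]
  refine Finset.sum_congr rfl fun s _ => ?_
  rw [mul_comm]
  congr 1
  refine Finset.prod_congr rfl fun i _ => ?_
  split_ifs <;> rfl

/-- The coefficients are real, so conjugation only acts on the coordinates. This symmetry is what
later makes the Wick rotations real valued. -/
theorem complexifyMultilinear_conj {n : ℕ}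
    (P : ContinuousMultilinearMap ℝ (fun _ : Fin n => ℝ × ℝ) ℝ) (z : ℂ × ℂ) :
    complexifyMultilinear P (fun _ => conjProd z)
      = starRingEnd ℂ (complexifyMultilinear P (fun _ => z)) := by
  simp only [complexifyMultilinear, sum_apply, smul_apply,
    ContinuousMultilinearMap.compContinuousLinearMap_apply,
    ContinuousMultilinearMap.mkPiAlgebraFin_apply, smul_eq_mul, List.prod_ofFn, map_sum, map_mul,
    map_prod, Complex.conj_ofReal]
  refine Finset.sum_congr rfl fun s _ => ?_
  congr 1
  refine Finset.prod_congr rfl fun i _ => ?_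
  split_ifs <;> rfl

/-- A real analytic germ extends holomorphically to a ball of `ℂ²`. -/
theorem AnalyticAt.exists_complexification {g : ℝ × ℝ → ℝ} {p : ℝ × ℝ} (hg : AnalyticAt ℝ g p) :
    ∃ r > 0, ∃ G : ℂ × ℂ → ℂ, AnalyticOnNhd ℂ G (Metric.ball (realToComplexProd p) r) ∧
      (∀ q ∈ Metric.ball p r, G (realToComplexProd q) = (g q : ℂ)) ∧
      ∀ z, G (conjProd z) = starRingEnd ℂ (G z) := by
  obtain ⟨P, R, hP⟩ := hg
  obtain ⟨ρ, hρ0, hρ⟩ := ENNReal.lt_iff_exists_nnreal_btwn.1 hP.r_pos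
  have hρ0' : 0 < ρ := by exact_mod_cast hρ0
  obtain ⟨C, -, hC⟩ := P.norm_mul_pow_le_of_lt_radius (hρ.trans_le hP.r_le)
  let Q : FormalMultilinearSeries ℂ (ℂ × ℂ) ℂ := fun n => complexifyMultilinear (P n)
  have hrad : ((ρ / 2 : NNReal) : ENNReal) ≤ Q.radius := by
    refine Q.le_radius_of_bound C fun n => ?_
    calc ‖Q n‖ * ((ρ / 2 : NNReal) : ℝ) ^ n ≤ (2 ^ n * ‖P n‖) * ((ρ / 2 : NNReal) : ℝ) ^ n := by
          gcongr; exact norm_complexifyMultilinear_le _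
      _ = ‖P n‖ * (ρ : ℝ) ^ n := by
          push_cast; rw [div_pow]; field_simp
      _ ≤ C := hC n
  have hpos : (0 : ENNReal) < ((ρ / 2 : NNReal) : ENNReal) := by
    exact_mod_cast half_pos hρ0'
  have hQ := ((Q.hasFPowerSeriesOnBall (hpos.trans_le hrad)).mono hpos hrad).comp_sub
    (realToComplexProd p)
  rw [zero_add] at hQ
  refine ⟨(ρ / 2 : NNReal), by exact_mod_cast half_pos hρ0',
    fun z => Q.sum (z - realToComplexProd p), ?_, ?_, fun z => ?_⟩
  · have := hQ.analyticOnNhd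
    rwa [Metric.eball_coe] at this
  · intro q hq
    have hq' : q - p ∈ Metric.eball (0 : ℝ × ℝ) R := by
      have h1 : ‖q - p‖ < (ρ : ℝ) := by
        rw [← dist_eq_norm]
        refine (Metric.mem_ball.1 hq).trans ?_
        push_cast
        have : (0 : ℝ) < ρ := hρ0'
        linarith
      rw [Metric.mem_eball, edist_zero_right]
      refine lt_trans ?_ hρ
      rw [enorm_eq_nnnorm]
      exact_mod_cast h1
    have hs := hP.hasSum hq'
    rw [add_sub_cancel] at hs
    have hs' : HasSum (fun n => ((P n (fun _ => q - p) : ℝ) : ℂ)) ((g q : ℝ) : ℂ) :=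
      Complex.hasSum_ofReal.2 hs
    rw [← hs'.tsum_eq]
    have hsub : realToComplexProd q - realToComplexProd p = realToComplexProd (q - p) := by
      simp [realToComplexProd]
    show Q.sum _ = _
    rw [FormalMultilinearSeries.sum, hsub]
    exact tsum_congr fun n => complexifyMultilinear_apply_real (P n) (q - p)
  · have hsub : conjProd z - realToComplexProd p = conjProd (z - realToComplexProd p) := by
      simp [realToComplexProd, conjProd]
    show Q.sum _ = starRingEnd ℂ (Q.sum _)
    rw [hsub, FormalMultilinearSeries.sum, FormalMultilinearSeries.sum,
      tsum_congr fun n => complexifyMultilinear_conj (P n) (z - realToComplexProd p)]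
    exact (Complex.conjCLE.map_tsum).symm

/-! ### Identity theorems from real points -/

theorem tendsto_ofReal_nhdsNE (x : ℝ) :
    Filter.Tendsto (fun t : ℝ => (t : ℂ)) (𝓝[≠] x) (𝓝[≠] (x : ℂ)) := by
  refine tendsto_nhdsWithin_of_tendsto_nhds_of_eventually_within _
    ((Complex.continuous_ofReal.tendsto x).mono_left nhdsWithin_le_nhds) ?_
  filter_upwards [self_mem_nhdsWithin] with t ht
  simpa using ht

/-- The real points near `x` accumulate at `x` in `ℂ`, which is all that the identity theorem in one
variable needs. -/
theorem AnalyticOnNhd.eqOn_zero_of_eventually_ofReal {f : ℂ → ℂ} {D : Set ℂ} {x : ℝ}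
    (hf : AnalyticOnNhd ℂ f D) (hD : IsPreconnected D) (hx : (x : ℂ) ∈ D)
    (h : ∀ᶠ t : ℝ in 𝓝 x, f t = 0) : ∀ z ∈ D, f z = 0 := by
  have h1 : ∃ᶠ z in 𝓝[≠] (x : ℂ), f z = 0 := by
    refine (tendsto_ofReal_nhdsNE x).frequently (p := fun z => f z = 0) ?_
    exact (h.filter_mono nhdsWithin_le_nhds).frequently
  exact hf.eqOn_zero_of_preconnected_of_frequently_eq_zero hD hx h1

theorem AnalyticAt.eventually_eq_zero_of_ofReal {f : ℂ → ℂ} {x : ℝ}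
    (hf : AnalyticAt ℂ f x) (h : ∀ᶠ t : ℝ in 𝓝 x, f t = 0) : ∀ᶠ z in 𝓝 (x : ℂ), f z = 0 := by
  obtain ⟨r, hr, hb⟩ := Metric.eventually_nhds_iff_ball.1 hf.eventually_analyticAt
  filter_upwards [Metric.ball_mem_nhds _ hr] with z hz
  exact AnalyticOnNhd.eqOn_zero_of_eventually_ofReal hb (convex_ball _ _).isPreconnected
    (Metric.mem_ball_self hr) h z hz

/-- Balls of the sup norm are products, so the identity theorem applies in one variable at a time:
first in `z` for real second coordinate, then in `w` for every complex `z`. -/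
theorem AnalyticAt.eventually_eq_zero_of_realToComplexProd {F : ℂ × ℂ → ℂ} {p : ℝ × ℝ}
    (hF : AnalyticAt ℂ F (realToComplexProd p))
    (h : ∀ᶠ q in 𝓝 p, F (realToComplexProd q) = 0) :
    ∀ᶠ z in 𝓝 (realToComplexProd p), F z = 0 := by
  obtain ⟨r₁, hr₁, hb₁⟩ := Metric.eventually_nhds_iff_ball.1 hF.eventually_analyticAt
  obtain ⟨r₂, hr₂, hb₂⟩ := Metric.eventually_nhds_iff_ball.1 h
  set r := min r₁ r₂
  have hr : 0 < r := lt_min hr₁ hr₂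
  have hA : ∀ z ∈ Metric.ball (p.1 : ℂ) r, ∀ w ∈ Metric.ball (p.2 : ℂ) r,
      AnalyticAt ℂ F (z, w) := by
    intro z hz w hw
    refine hb₁ _ (Metric.ball_subset_ball (min_le_left r₁ r₂) ?_)
    rw [realToComplexProd, ← ball_prod_same]
    exact ⟨hz, hw⟩
  have hR : ∀ x ∈ Metric.ball p.1 r, ∀ y ∈ Metric.ball p.2 r, F ((x : ℂ), (y : ℂ)) = 0 := by
    intro x hx y hy
    refine hb₂ (x, y) (Metric.ball_subset_ball (min_le_right r₁ r₂) ?_)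
    rw [← Prod.mk.eta (p := p), ← ball_prod_same]
    exact ⟨hx, hy⟩
  have hcast : ∀ x a : ℝ, x ∈ Metric.ball a r → (x : ℂ) ∈ Metric.ball (a : ℂ) r := by
    intro x a hx
    rw [Metric.mem_ball, Complex.dist_eq, ← Complex.ofReal_sub, Complex.norm_real]
    simpa [Real.dist_eq] using hx
  have hball : ∀ a : ℂ, IsPreconnected (Metric.ball a r) := fun a =>
    (convex_ball a r).isPreconnected
  have h1 : ∀ y ∈ Metric.ball p.2 r, ∀ z ∈ Metric.ball (p.1 : ℂ) r, F (z, (y : ℂ)) = 0 := by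
    intro y hy
    refine AnalyticOnNhd.eqOn_zero_of_eventually_ofReal (f := fun z => F (z, (y : ℂ)))
      (x := p.1) ?_ (hball _) (Metric.mem_ball_self hr) ?_
    · intro z hz
      exact (hA z hz y (hcast _ _ hy)).comp₂ analyticAt_id analyticAt_const
    · filter_upwards [Metric.ball_mem_nhds p.1 hr] with x hx using hR x hx y hy
  have h2 : ∀ z ∈ Metric.ball (p.1 : ℂ) r, ∀ w ∈ Metric.ball (p.2 : ℂ) r, F (z, w) = 0 := by
    intro z hz
    refine AnalyticOnNhd.eqOn_zero_of_eventually_ofReal (f := fun w => F (z, w))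
      (x := p.2) ?_ (hball _) (Metric.mem_ball_self hr) ?_
    · intro w hw
      exact (hA z hz w hw).comp₂ analyticAt_const analyticAt_id
    · filter_upwards [Metric.ball_mem_nhds p.2 hr] with y hy using h1 y hy z hz
  filter_upwards [Metric.ball_mem_nhds _ hr] with z hz
  rw [realToComplexProd, ← ball_prod_same] at hz
  exact h2 z.1 hz.1 z.2 hz.2

/-- A real analytic function on an open subset of `ℝ²` extends holomorphically to an open
neighbourhood of that set in `ℂ²`. -/
theorem AnalyticOnNhd.exists_complexification {g : ℝ × ℝ → ℝ} {U : Set (ℝ × ℝ)}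
    (hg : AnalyticOnNhd ℝ g U) :
    ∃ (Ω : Set (ℂ × ℂ)) (G : ℂ × ℂ → ℂ), IsOpen Ω ∧ AnalyticOnNhd ℂ G Ω ∧
      ∀ p ∈ U, realToComplexProd p ∈ Ω ∧
        (∀ᶠ q in 𝓝 p, G (realToComplexProd q) = (g q : ℂ)) ∧
        ∀ᶠ z in 𝓝 (realToComplexProd p), G (conjProd z) = starRingEnd ℂ (G z) := by
  choose! r hr G hG hGg hGc using fun p (hp : p ∈ U) => (hg p hp).exists_complexification
  set Ω : Set (ℂ × ℂ) := ⋃ p ∈ U, Metric.ball (realToComplexProd p) (r p) with hΩ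
  have hmem : ∀ z ∈ Ω, ∃ p ∈ U, z ∈ Metric.ball (realToComplexProd p) (r p) := by
    intro z hz
    simpa [hΩ] using hz
  choose! c hcU hc using hmem
  have hre : ∀ z : ℂ × ℂ, ∀ p : ℝ × ℝ, ∀ s, z ∈ Metric.ball (realToComplexProd p) s →
      (z.1.re, z.2.re) ∈ Metric.ball p s := by
    intro z p s hz
    rw [realToComplexProd, ← ball_prod_same] at hz
    obtain ⟨h1, h2⟩ := hz
    rw [← Prod.mk.eta (p := p), ← ball_prod_same]
    rw [Metric.mem_ball, Complex.dist_eq] at h1 h2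
    constructor
    · rw [Metric.mem_ball, Real.dist_eq]
      refine lt_of_le_of_lt ?_ h1
      simpa using Complex.abs_re_le_norm (z.1 - p.1)
    · rw [Metric.mem_ball, Real.dist_eq]
      refine lt_of_le_of_lt ?_ h2
      simpa using Complex.abs_re_le_norm (z.2 - p.2)
  have hagree : ∀ p ∈ U, ∀ q ∈ U, ∀ z ∈ Metric.ball (realToComplexProd p) (r p),
      z ∈ Metric.ball (realToComplexProd q) (r q) → G p z = G q z := by
    intro p hp q hq z hzp hzq
    -- If two balls with real centres share the point `z`, both contain its real part. Near that
    -- point both extensions equal `g`, and the intersection of the balls is convex, so they agree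
    -- on all of it.
    set m : ℝ × ℝ := (z.1.re, z.2.re) with hm
    have hmp := hre z p _ hzp
    have hmq := hre z q _ hzq
    have hιm : ∀ p', m ∈ Metric.ball p' (r p') →
        realToComplexProd m ∈ Metric.ball (realToComplexProd p') (r p') := by
      intro p' h
      rwa [Metric.mem_ball, dist_realToComplexProd]
    have hev := AnalyticAt.eventually_eq_zero_of_realToComplexProd (p := m)
      (F := fun z => G p z - G q z)
      ((hG p hp _ (hιm p hmp)).sub (hG q hq _ (hιm q hmq))) (by
        filter_upwards [Metric.isOpen_ball.mem_nhds hmp, Metric.isOpen_ball.mem_nhds hmq]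
          with x hx hx'
        rw [hGg p hp x hx, hGg q hq x hx', sub_self])
    have hpre : IsPreconnected (Metric.ball (realToComplexProd p) (r p) ∩
        Metric.ball (realToComplexProd q) (r q)) :=
      ((convex_ball _ _).inter (convex_ball _ _)).isPreconnected
    have h1 : AnalyticOnNhd ℂ (G p) (Metric.ball (realToComplexProd p) (r p) ∩
        Metric.ball (realToComplexProd q) (r q)) := fun x hx => hG p hp x hx.1
    have h2 : AnalyticOnNhd ℂ (G q) (Metric.ball (realToComplexProd p) (r p) ∩
        Metric.ball (realToComplexProd q) (r q)) := fun x hx => hG q hq x hx.2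
    refine h1.eqOn_of_preconnected_of_eventuallyEq h2 hpre ⟨hιm p hmp, hιm q hmq⟩ ?_ ⟨hzp, hzq⟩
    filter_upwards [hev] with x hx using sub_eq_zero.1 hx
  have hsub : ∀ p ∈ U, Metric.ball (realToComplexProd p) (r p) ⊆ Ω := fun p hp =>
    Set.subset_biUnion_of_mem (u := fun p => Metric.ball (realToComplexProd p) (r p)) hp
  have heq : ∀ p ∈ U, ∀ z ∈ Metric.ball (realToComplexProd p) (r p), G (c z) z = G p z := by
    intro p hp z hz
    exact hagree _ (hcU z (hsub p hp hz)) p hp z (hc z (hsub p hp hz)) hz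
  refine ⟨Ω, fun z => G (c z) z, ?_, ?_, ?_⟩
  · exact isOpen_biUnion fun p _ => Metric.isOpen_ball
  · intro z hz
    refine (hG (c z) (hcU z hz) z (hc z hz)).congr ?_
    filter_upwards [Metric.isOpen_ball.mem_nhds (hc z hz)] with w hw
    exact (heq _ (hcU z hz) w hw).symm
  · intro p hp
    refine ⟨hsub p hp (Metric.mem_ball_self (hr p hp)), ?_, ?_⟩
    · filter_upwards [Metric.ball_mem_nhds p (hr p hp)] with q hq
      rw [heq p hp _ (by rwa [Metric.mem_ball, dist_realToComplexProd]), hGg p hp q hq]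
    · have hb := Metric.ball_mem_nhds (realToComplexProd p) (hr p hp)
      have hc : Filter.Tendsto conjProd (𝓝 (realToComplexProd p)) (𝓝 (realToComplexProd p)) := by
        simpa [conjProd_realToComplexProd] using continuous_conjProd.tendsto (realToComplexProd p)
      filter_upwards [hb, hc hb] with z hz hz'
      rw [heq p hp z hz, heq p hp _ hz', hGc p hp z]

/-! ### Partial derivatives -/

theorem AnalyticAt.pd1 {f : ℝ × ℝ → ℝ} {p : ℝ × ℝ} (hf : AnalyticAt ℝ f p) :
    AnalyticAt ℝ (pd1 f) p :=
  ((ContinuousLinearMap.apply ℝ ℝ ((1 : ℝ), (0 : ℝ))).analyticAt _).comp hf.fderiv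

theorem AnalyticAt.pd2 {f : ℝ × ℝ → ℝ} {p : ℝ × ℝ} (hf : AnalyticAt ℝ f p) :
    AnalyticAt ℝ (pd2 f) p :=
  ((ContinuousLinearMap.apply ℝ ℝ ((0 : ℝ), (1 : ℝ))).analyticAt _).comp hf.fderiv

theorem AnalyticAt.hasDerivAt_pd1 {f : ℝ × ℝ → ℝ} {x y : ℝ} (hf : AnalyticAt ℝ f (x, y)) :
    HasDerivAt (fun x' => f (x', y)) (_root_.pd1 f (x, y)) x :=
  hf.differentiableAt.hasFDerivAt.comp_hasDerivAt x
    ((hasDerivAt_id x).prodMk (hasDerivAt_const x y))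

theorem AnalyticAt.hasDerivAt_pd2 {f : ℝ × ℝ → ℝ} {x y : ℝ} (hf : AnalyticAt ℝ f (x, y)) :
    HasDerivAt (fun y' => f (x, y')) (_root_.pd2 f (x, y)) y :=
  hf.differentiableAt.hasFDerivAt.comp_hasDerivAt y
    ((hasDerivAt_const y x).prodMk (hasDerivAt_id y))

theorem pd2_congr {f g : ℝ × ℝ → ℝ} {p : ℝ × ℝ} (h : f =ᶠ[𝓝 p] g) : pd2 f p = pd2 g p := by
  rw [pd2, pd2, h.fderiv_eq]

theorem AnalyticAt.pd1_pd2_comm {f : ℝ × ℝ → ℝ} {p : ℝ × ℝ} (hf : AnalyticAt ℝ f p) :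
    _root_.pd1 (_root_.pd2 f) p = _root_.pd2 (_root_.pd1 f) p := by
  have hsymm : IsSymmSndFDerivAt ℝ f p := hf.contDiffAt.isSymmSndFDerivAt_of_omega
  have hd : DifferentiableAt ℝ (fderiv ℝ f) p := hf.fderiv.differentiableAt
  have key : ∀ v w : ℝ × ℝ,
      fderiv ℝ (fun q => fderiv ℝ f q v) p w = fderiv ℝ (fderiv ℝ f) p w v := by
    intro v w
    rw [fderiv_clm_apply hd (differentiableAt_const v)]
    simp
  show fderiv ℝ (fun q => fderiv ℝ f q (0, 1)) p (1, 0)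
    = fderiv ℝ (fun q => fderiv ℝ f q (1, 0)) p (0, 1)
  rw [key, key, hsymm]

theorem tendsto_mk_zero_left : Filter.Tendsto (fun y : ℝ => ((0 : ℝ), y)) (𝓝 0) (𝓝 (0, 0)) :=
  (Continuous.prodMk_right (0 : ℝ)).tendsto 0

theorem tendsto_mk_zero_right : Filter.Tendsto (fun t : ℝ => (t, (0 : ℝ))) (𝓝 0) (𝓝 (0, 0)) :=
  (Continuous.prodMk_left (0 : ℝ)).tendsto 0

/-! ### Linear ordinary differential equations for analytic functions -/

/-- Grönwall's inequality gives zeros to the right of `0`; these accumulate at `0`, and analyticity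
carries the vanishing to the left side. -/
theorem AnalyticAt.eventually_eq_zero_of_norm_deriv_le {E : Type*} [NormedAddCommGroup E]
    [NormedSpace ℝ E] [CompleteSpace E] {w : ℝ → E} {K : ℝ} (hw : AnalyticAt ℝ w 0) (h0 : w 0 = 0)
    (hd : ∀ᶠ y in 𝓝 (0 : ℝ), ‖deriv w y‖ ≤ K * ‖w y‖) : ∀ᶠ y in 𝓝 (0 : ℝ), w y = 0 := by
  obtain ⟨δ, hδ, hb⟩ := Metric.eventually_nhds_iff_ball.1 (hw.eventually_analyticAt.and hd)
  have hmem : ∀ y ∈ Set.Icc (0 : ℝ) (δ / 2), y ∈ Metric.ball (0 : ℝ) δ := by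
    intro y hy
    rw [Metric.mem_ball, Real.dist_eq, sub_zero, abs_of_nonneg hy.1]
    linarith [hy.2]
  have hz : ∀ y ∈ Set.Icc (0 : ℝ) (δ / 2), w y = 0 := by
    refine eq_zero_of_abs_deriv_le_mul_abs_self_of_eq_zero_right (f' := deriv w) (K := K)
      ?_ ?_ h0 ?_
    · exact fun y hy => (hb y (hmem y hy)).1.continuousAt.continuousWithinAt
    · exact fun y hy =>
        (hb y (hmem y (Set.Ico_subset_Icc_self hy))).1.differentiableAt.hasDerivAt.hasDerivWithinAt
    · exact fun y hy => (hb y (hmem y (Set.Ico_subset_Icc_self hy))).2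
  refine hw.frequently_zero_iff_eventually_zero.1 ?_
  have h1 : ∀ᶠ y in 𝓝[>] (0 : ℝ), w y = 0 := by
    filter_upwards [Ioc_mem_nhdsGT (half_pos hδ)] with y hy
    exact hz y ⟨hy.1.le, hy.2⟩
  exact h1.frequently.filter_mono (nhdsWithin_mono 0 fun y hy => ne_of_gt hy)

/-- In the sup norm of the vector `w`, the continuous coefficients are bounded near `0` by `|a i j
0| + 1`, so the system implies a scalar Grönwall bound. -/
theorem eventually_eq_zero_of_linear_system {ι : Type*} [Fintype ι] {w : ι → ℝ → ℝ}
    {a : ι → ι → ℝ → ℝ} (hw : ∀ i, AnalyticAt ℝ (w i) 0) (ha : ∀ i j, ContinuousAt (a i j) 0)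
    (h0 : ∀ i, w i 0 = 0)
    (hd : ∀ᶠ y in 𝓝 (0 : ℝ), ∀ i, deriv (w i) y = ∑ j, a i j y * w j y) :
    ∀ᶠ y in 𝓝 (0 : ℝ), ∀ i, w i y = 0 := by
  have hW : AnalyticAt ℝ (fun y i => w i y) 0 := AnalyticAt.pi hw
  have hbd : ∀ᶠ y in 𝓝 (0 : ℝ), ∀ i j, |a i j y| ≤ |a i j 0| + 1 := by
    refine Filter.eventually_all.2 fun i => Filter.eventually_all.2 fun j => ?_
    have : Filter.Tendsto (fun y => |a i j y|) (𝓝 0) (𝓝 |a i j 0|) := (ha i j).abs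
    exact (this.eventually (gt_mem_nhds (lt_add_one _))).mono fun y hy => hy.le
  have := AnalyticAt.eventually_eq_zero_of_norm_deriv_le (w := fun y i => w i y)
    (K := ∑ i, ∑ j, (|a i j 0| + 1)) hW (funext h0) ?_
  · exact this.mono fun y hy i => congrFun hy i
  have han : ∀ᶠ y in 𝓝 (0 : ℝ), ∀ i, AnalyticAt ℝ (w i) y :=
    Filter.eventually_all.2 fun i => (hw i).eventually_analyticAt
  filter_upwards [hd, hbd, han] with y hy hb hany
  have hderiv : deriv (fun y i => w i y) y = fun i => deriv (w i) y :=
    deriv_pi fun i => (hany i).differentiableAt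
  rw [hderiv]
  refine (pi_norm_le_iff_of_nonneg (by positivity)).2 fun i => ?_
  rw [hy i]
  refine (norm_sum_le _ _).trans ?_
  calc ∑ j, ‖a i j y * w j y‖ ≤ ∑ j, (|a i j 0| + 1) * ‖fun i => w i y‖ := by
        refine Finset.sum_le_sum fun j _ => ?_
        rw [norm_mul]
        exact mul_le_mul (hb i j) (norm_le_pi_norm (fun i => w i y) j) (norm_nonneg _)
          (by positivity)
    _ = (∑ j, (|a i j 0| + 1)) * ‖fun i => w i y‖ := by rw [Finset.sum_mul]
    _ ≤ _ := by
        refine mul_le_mul_of_nonneg_right ?_ (norm_nonneg _)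
        exact Finset.single_le_sum (f := fun i => ∑ j, (|a i j 0| + 1))
          (fun i _ => by positivity) (Finset.mem_univ i)

/-! ### Zero mean curvature graphs along a lightlike line -/

/-- The left-hand side of the zero mean curvature equation. -/
noncomputable def zmcExpr (k : ℝ × ℝ → ℝ) (p : ℝ × ℝ) : ℝ :=
  (1 - pd2 k p ^ 2) * pd1 (pd1 k) p + 2 * pd1 k p * pd2 k p * pd2 (pd1 k) p
    + (1 - pd1 k p ^ 2) * pd2 (pd2 k) p

/-- The first derivative of the zero mean curvature equation in the first variable. -/
theorem zmcExpr_deriv {k : ℝ × ℝ → ℝ} {p : ℝ × ℝ} (hk : AnalyticAt ℝ k p)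
    (hE : ∀ᶠ q in 𝓝 p, zmcExpr k q = 0) :
    (1 - pd2 k p ^ 2) * pd1 (pd1 (pd1 k)) p + 2 * pd1 k p * pd2 (pd1 k) p ^ 2
      + 2 * pd1 k p * pd2 k p * pd2 (pd1 (pd1 k)) p
      - 2 * pd1 k p * pd1 (pd1 k) p * pd2 (pd2 k) p
      + (1 - pd1 k p ^ 2) * pd2 (pd2 (pd1 k)) p = 0 := by
  obtain ⟨x, y⟩ := p
  have hP := hk.pd2.hasDerivAt_pd1
  rw [hk.pd1_pd2_comm] at hP
  have hQ := hk.pd1.hasDerivAt_pd1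
  have hR := hk.pd1.pd1.hasDerivAt_pd1
  have hS := hk.pd1.pd2.hasDerivAt_pd1
  rw [hk.pd1.pd1_pd2_comm] at hS
  have hT := hk.pd2.pd2.hasDerivAt_pd1
  have hcomm : pd1 (pd2 k) =ᶠ[𝓝 (x, y)] pd2 (pd1 k) :=
    hk.eventually_analyticAt.mono fun q hq => hq.pd1_pd2_comm
  rw [hk.pd2.pd1_pd2_comm, pd2_congr hcomm] at hT
  have h := ((((hP.pow 2).const_sub 1).mul hR).add (((hQ.const_mul 2).mul hP).mul hS)).add
    (((hQ.pow 2).const_sub 1).mul hT)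
  have hz : HasDerivAt (fun x' => zmcExpr k (x', y)) 0 x := by
    refine (hasDerivAt_const x (0 : ℝ)).congr_of_eventuallyEq ?_
    exact ((Continuous.prodMk_left y).tendsto x).eventually hE
  have h' := hz.unique h
  simp only [Pi.pow_apply, Pi.mul_apply] at h'
  linear_combination -h'

/-- Along a lightlike line, the second derivative of the zero mean curvature equation in the
first variable. -/
theorem zmcExpr_deriv_deriv {k : ℝ × ℝ → ℝ} {p : ℝ × ℝ} (hk : AnalyticAt ℝ k p)
    (hE : ∀ᶠ q in 𝓝 p, zmcExpr k q = 0) (hQ0 : pd1 k p = 0) (hP0 : pd2 k p ^ 2 = 1)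
    (hS0 : pd2 (pd1 k) p = 0) (hT0 : pd2 (pd2 k) p = 0) :
    pd2 (pd2 (pd1 (pd1 k))) p + 2 * pd2 k p * pd1 (pd1 k) p * pd2 (pd1 (pd1 k)) p = 0 := by
  have hE1 := (hk.eventually_analyticAt.and hE.eventually_nhds).mono
    fun q hq => zmcExpr_deriv hq.1 hq.2
  obtain ⟨x, y⟩ := p
  have hP := hk.pd2.hasDerivAt_pd1
  rw [hk.pd1_pd2_comm] at hP
  have hQ := hk.pd1.hasDerivAt_pd1
  have hR := hk.pd1.pd1.hasDerivAt_pd1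
  have hS := hk.pd1.pd2.hasDerivAt_pd1
  have hT := hk.pd2.pd2.hasDerivAt_pd1
  have hR1 := hk.pd1.pd1.pd1.hasDerivAt_pd1
  have hR2 := hk.pd1.pd1.pd2.hasDerivAt_pd1
  have hS2 := hk.pd1.pd2.pd2.hasDerivAt_pd1
  have hcomm : pd1 (pd2 (pd1 k)) =ᶠ[𝓝 (x, y)] pd2 (pd1 (pd1 k)) :=
    hk.pd1.eventually_analyticAt.mono fun q hq => hq.pd1_pd2_comm
  rw [hk.pd1.pd2.pd1_pd2_comm, pd2_congr hcomm] at hS2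
  have h := ((((((hP.pow 2).const_sub 1).mul hR1).add ((hQ.const_mul 2).mul (hS.pow 2))).add
    (((hQ.const_mul 2).mul hP).mul hR2)).sub (((hQ.const_mul 2).mul hR).mul hT)).add
    (((hQ.pow 2).const_sub 1).mul hS2)
  have hz := (hasDerivAt_const x (0 : ℝ)).congr_of_eventuallyEq
    (((Continuous.prodMk_left y).tendsto x).eventually hE1)
  have h' := hz.unique h
  -- Almost every product keeps a factor `k_x`, `k_xy`, `k_yy` or `1 - k_y²`, all zero here. Only
  -- `k_xxyy` and the term of `2 k_x k_y k_xxy` in which `k_x` is differentiated survive.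
  simp only [Pi.pow_apply, Pi.mul_apply, hQ0, hS0, hT0, hP0] at h'
  linear_combination -h'

/-- A zero mean curvature graph that is tangent to the lightlike direction `(ε, 0, 1)` to
sufficiently high order at a point contains a lightlike segment, and is tangent to a lightlike
plane along it. -/
theorem zmc_contains_lightlike_line {k : ℝ × ℝ → ℝ} {ε : ℝ} (hk : AnalyticAt ℝ k (0, 0))
    (hE : ∀ᶠ q in 𝓝 (0, 0), zmcExpr k q = 0) (hε : ε ^ 2 = 1) (hQ0 : pd1 k (0, 0) = 0)
    (hP0 : pd2 k (0, 0) = ε) (hS0 : pd2 (pd1 k) (0, 0) = 0) :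
    ∀ᶠ y in 𝓝 (0 : ℝ), pd1 k (0, y) = 0 ∧ pd2 k (0, y) = ε ∧ pd2 (pd1 k) (0, y) = 0 := by
  have hline : AnalyticAt ℝ (fun y : ℝ => ((0 : ℝ), y)) 0 := analyticAt_const.prod analyticAt_id
  have hres : ∀ {f : ℝ × ℝ → ℝ}, AnalyticAt ℝ f (0, 0) → AnalyticAt ℝ (fun y => f (0, y)) 0 :=
    fun {f} hf => AnalyticAt.comp (g := f) (f := fun y : ℝ => ((0 : ℝ), y)) hf hline
  have hresC : ∀ {f : ℝ × ℝ → ℝ}, AnalyticAt ℝ f (0, 0) → ContinuousAt (fun y => f (0, y)) 0 :=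
    fun hf => (hres hf).continuousAt
  have hQ := hresC hk.pd1
  have hP := hresC hk.pd2
  have hR := hresC hk.pd1.pd1
  have hS := hresC hk.pd1.pd2
  have hT := hresC hk.pd2.pd2
  have hR1 := hresC hk.pd1.pd1.pd1
  have hR2 := hresC hk.pd1.pd1.pd2
  have hne : (1 - pd1 k (0, 0) ^ 2) ≠ 0 := by rw [hQ0]; norm_num
  have hden : ContinuousAt (fun y => (1 - pd1 k (0, y) ^ 2)⁻¹) 0 :=
    (continuousAt_const.sub (hQ.pow 2)).inv₀ hne
  have hnear : ∀ᶠ y in 𝓝 (0 : ℝ), 1 - pd1 k (0, y) ^ 2 ≠ 0 :=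
    (continuousAt_const.sub (hQ.pow 2)).eventually_ne hne
  -- The rows come from solving the equation for `k_yy` and its `x`-derivative for `k_xyy`, after
  -- division by `1 - k_x²`, which is nonzero near `0`. Writing `1 - k_y² = -(k_y - ε)(k_y + ε)`
  -- makes the system homogeneous in `w`; the remaining derivatives of `k` are treated as known
  -- continuous coefficients.
  let w : Fin 3 → ℝ → ℝ := ![fun y => pd2 k (0, y) - ε, fun y => pd1 k (0, y),
    fun y => pd2 (pd1 k) (0, y)]
  let a : Fin 3 → Fin 3 → ℝ → ℝ := ![
    ![fun y => (pd2 k (0, y) + ε) * pd1 (pd1 k) (0, y) * (1 - pd1 k (0, y) ^ 2)⁻¹,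
      fun y => -(2 * pd2 k (0, y) * pd2 (pd1 k) (0, y)) * (1 - pd1 k (0, y) ^ 2)⁻¹,
      fun _ => 0],
    ![fun _ => 0, fun _ => 0, fun _ => 1],
    ![fun y => (pd2 k (0, y) + ε) * pd1 (pd1 (pd1 k)) (0, y) * (1 - pd1 k (0, y) ^ 2)⁻¹,
      fun y => -(2 * pd2 (pd1 k) (0, y) ^ 2 + 2 * pd2 k (0, y) * pd2 (pd1 (pd1 k)) (0, y)
        - 2 * pd1 (pd1 k) (0, y) * pd2 (pd2 k) (0, y)) * (1 - pd1 k (0, y) ^ 2)⁻¹,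
      fun _ => 0]]
  have key := eventually_eq_zero_of_linear_system (w := w) (a := a) ?_ ?_ ?_ ?_
  · filter_upwards [key] with y hy
    exact ⟨hy 1, sub_eq_zero.1 (hy 0), hy 2⟩
  · intro i
    fin_cases i
    · exact (hres hk.pd2).sub analyticAt_const
    · exact hres hk.pd1
    · exact hres hk.pd1.pd2
  · intro i j
    fin_cases i <;> fin_cases j
    · exact ((hP.add continuousAt_const).mul hR).mul hden
    · exact (((continuousAt_const.mul hP).mul hS).neg).mul hden
    · exact continuousAt_const
    · exact continuousAt_const
    · exact continuousAt_const
    · exact continuousAt_const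
    · exact ((hP.add continuousAt_const).mul hR1).mul hden
    · exact ((((continuousAt_const.mul (hS.pow 2)).add ((continuousAt_const.mul hP).mul hR2)).sub
        ((continuousAt_const.mul hR).mul hT)).neg).mul hden
    · exact continuousAt_const
  · intro i
    fin_cases i
    · exact sub_eq_zero.2 hP0
    · exact hQ0
    · exact hS0
  · filter_upwards [hnear, tendsto_mk_zero_left.eventually hE.eventually_nhds,
      tendsto_mk_zero_left.eventually hk.eventually_analyticAt] with y hy hEy hky
    have hE0 := hEy.self_of_nhds
    have hE1 := zmcExpr_deriv hky hEy
    rw [zmcExpr] at hE0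
    intro i
    fin_cases i
    · have hd : deriv (w 0) y = pd2 (pd2 k) (0, y) := (hky.pd2.hasDerivAt_pd2.sub_const ε).deriv
      simp only [Fin.zero_eta, hd, Fin.sum_univ_three]
      simp only [w, a, Matrix.cons_val]
      field_simp
      linear_combination hE0 + pd1 (pd1 k) (0, y) * hε
    · have hd : deriv (w 1) y = pd2 (pd1 k) (0, y) := hky.pd1.hasDerivAt_pd2.deriv
      simp only [Fin.mk_one, hd, Fin.sum_univ_three]
      simp [w, a]
    · have hd : deriv (w 2) y = pd2 (pd2 (pd1 k)) (0, y) := hky.pd1.pd2.hasDerivAt_pd2.deriv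
      simp only [Fin.reduceFinMk, hd, Fin.sum_univ_three]
      simp only [w, a, Matrix.cons_val]
      field_simp
      linear_combination hE1 + pd1 (pd1 (pd1 k)) (0, y) * hε

/-- The Riccati equation for the approximation function along a lightlike line. -/
theorem zmc_riccati {k : ℝ × ℝ → ℝ} {ε : ℝ} (hk : AnalyticAt ℝ k (0, 0))
    (hE : ∀ᶠ q in 𝓝 (0, 0), zmcExpr k q = 0) (hε : ε ^ 2 = 1)
    (hl : ∀ᶠ y in 𝓝 (0 : ℝ), pd1 k (0, y) = 0 ∧ pd2 k (0, y) = ε ∧ pd2 (pd1 k) (0, y) = 0) :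
    ∃ D : ℝ, ∀ᶠ y in 𝓝 (0 : ℝ),
      pd2 (pd1 (pd1 k)) (0, y) + ε * pd1 (pd1 k) (0, y) ^ 2 = D := by
  have hev : ∀ᶠ y in 𝓝 (0 : ℝ), HasDerivAt
      (fun y => pd2 (pd1 (pd1 k)) (0, y) + ε * pd1 (pd1 k) (0, y) ^ 2) 0 y := by
    filter_upwards [hl.eventually_nhds, tendsto_mk_zero_left.eventually hE.eventually_nhds,
      tendsto_mk_zero_left.eventually hk.eventually_analyticAt] with y hly hEy hky
    obtain ⟨hQ0, hP0, hS0⟩ := hly.self_of_nhds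
    have hT0 : pd2 (pd2 k) (0, y) = 0 := by
      refine hky.pd2.hasDerivAt_pd2.unique ?_
      exact (hasDerivAt_const y ε).congr_of_eventuallyEq (hly.mono fun _ h => h.2.1)
    have h2 := zmcExpr_deriv_deriv hky hEy hQ0 (by rw [hP0, hε]) hS0 hT0
    have h3 := hky.pd1.pd1.pd2.hasDerivAt_pd2.add
      ((hky.pd1.pd1.hasDerivAt_pd2.pow 2).const_mul ε)
    refine h3.congr_deriv ?_
    rw [hP0] at h2
    linear_combination h2
  obtain ⟨δ, hδ, hb⟩ := Metric.eventually_nhds_iff_ball.1 hev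
  refine ⟨pd2 (pd1 (pd1 k)) (0, 0) + ε * pd1 (pd1 k) (0, 0) ^ 2, ?_⟩
  filter_upwards [Metric.ball_mem_nhds (0 : ℝ) hδ] with y hy
  exact Metric.isOpen_ball.is_const_of_deriv_eq_zero (convex_ball (0 : ℝ) δ).isPreconnected
    (fun z hz => (hb z hz).differentiableAt.differentiableWithinAt) (fun z hz => (hb z hz).deriv)
    hy (Metric.mem_ball_self hδ)

/-! ### Classification of the solutions of the Riccati equation `α' + α² = D` -/

theorem IsOpenIntervalAtZero.isPreconnected {J : Set ℝ} (hJ : IsOpenIntervalAtZero J) :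
    IsPreconnected J := hJ.2.1.isPreconnected

theorem IsOpenIntervalAtZero.mem_nhds {J : Set ℝ} (hJ : IsOpenIntervalAtZero J) :
    J ∈ 𝓝 (0 : ℝ) := hJ.1.mem_nhds hJ.2.2

theorem IsOpenIntervalAtZero.inter {J J' : Set ℝ} (hJ : IsOpenIntervalAtZero J)
    (hJ' : IsOpenIntervalAtZero J') : IsOpenIntervalAtZero (J ∩ J') :=
  ⟨hJ.1.inter hJ'.1, hJ.2.1.inter hJ'.2.1, hJ.2.2, hJ'.2.2⟩

open Classical in
/-- The class of the solution of `α' + α² = D` with `α 0 = m`. -/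
noncomputable def riccatiClass (m D : ℝ) : LightlikeLineClass :=
  if D < 0 then .plus
  else if D = 0 then (if m = 0 then .zeroI else .zeroII)
  else if m ^ 2 < D then .minusI
  else if m ^ 2 = D then .minusIII
  else .minusII

/-- Logarithmic derivatives of solutions of `P'' = μ P` solve the Riccati equation. -/
theorem riccati_of_logDeriv {α P P' : ℝ → ℝ} {μ : ℝ} (hα : ∀ᶠ s in 𝓝 (0 : ℝ), α s = P' s / P s)
    (hP : HasDerivAt P (P' 0) 0) (hP' : HasDerivAt P' (μ * P 0) 0) (h0 : P 0 ≠ 0) :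
    deriv α 0 + α 0 ^ 2 = μ := by
  have h : HasDerivAt α _ 0 := (hP'.div hP h0).congr_of_eventuallyEq hα
  rw [h.deriv, hα.self_of_nhds]
  field_simp
  ring

/-- A solution of the Riccati equation is the logarithmic derivative of a solution of
`P'' = D P`. -/
theorem mul_eq_of_riccati {J : Set ℝ} {α P P' : ℝ → ℝ} {D : ℝ} (hJ : IsOpenIntervalAtZero J)
    (hα : AnalyticOnNhd ℝ α J) (hD : ∀ᶠ s in 𝓝 (0 : ℝ), deriv α s + α s ^ 2 = D)
    (hPa : AnalyticOnNhd ℝ P Set.univ) (hPa' : AnalyticOnNhd ℝ P' Set.univ)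
    (hP : ∀ s, HasDerivAt P (P' s) s) (hP' : ∀ s, HasDerivAt P' (D * P s) s)
    (h0 : α 0 * P 0 = P' 0) : ∀ s ∈ J, α s * P s = P' s := by
  -- The defect `w = α P - P'` satisfies `w' = -α w` and `w(0) = 0`, so it vanishes near `0` and
  -- then on all of `J`.
  have hw : AnalyticOnNhd ℝ (fun s => α s * P s - P' s) J := fun s hs =>
    ((hα s hs).mul (hPa s trivial)).sub (hPa' s trivial)
  have hα0 := hα 0 hJ.2.2
  have hz : ∀ᶠ s in 𝓝 (0 : ℝ), α s * P s - P' s = 0 := by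
    refine AnalyticAt.eventually_eq_zero_of_norm_deriv_le (K := |α 0| + 1) (hw 0 hJ.2.2)
      (sub_eq_zero.2 h0) ?_
    have hb : ∀ᶠ s in 𝓝 (0 : ℝ), |α s| < |α 0| + 1 :=
      hα0.continuousAt.abs.eventually (gt_mem_nhds (lt_add_one _))
    filter_upwards [hD, hb, hα0.eventually_analyticAt] with s hs hbs has
    have hd := (has.differentiableAt.hasDerivAt.mul (hP s)).sub (hP' s)
    have he : deriv (fun s => α s * P s - P' s) s = -α s * (α s * P s - P' s) := by
      refine hd.deriv.trans ?_
      rw [← hs]; ring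
    rw [he, norm_mul, norm_neg]
    exact mul_le_mul_of_nonneg_right hbs.le (norm_nonneg _)
  intro s hs
  have := hw.eqOn_of_preconnected_of_eventuallyEq (g := fun _ => 0)
    (fun _ _ => analyticAt_const) hJ.isPreconnected hJ.2.2 hz hs
  exact sub_eq_zero.1 this

theorem hasDerivAt_affine (k c s : ℝ) : HasDerivAt (fun s => k * s + c) k s := by
  simpa using ((hasDerivAt_id s).const_mul k).add_const c

theorem analyticOnNhd_affine (k c : ℝ) : AnalyticOnNhd ℝ (fun s => k * s + c) Set.univ :=
  fun _ _ => (analyticAt_const.mul analyticAt_id).add analyticAt_const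

theorem hasDerivAt_cos_affine (k c s : ℝ) :
    HasDerivAt (fun s => Real.cos (k * s + c)) (-k * Real.sin (k * s + c)) s := by
  refine (hasDerivAt_affine k c s).cos.congr_deriv ?_
  ring

theorem hasDerivAt_sin_affine (k c s : ℝ) :
    HasDerivAt (fun s => -k * Real.sin (k * s + c)) (-k ^ 2 * Real.cos (k * s + c)) s := by
  refine ((hasDerivAt_affine k c s).sin.const_mul (-k)).congr_deriv ?_
  ring

theorem hasDerivAt_cosh_affine (k c s : ℝ) :
    HasDerivAt (fun s => Real.cosh (k * s + c)) (k * Real.sinh (k * s + c)) s := by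
  refine (hasDerivAt_affine k c s).cosh.congr_deriv ?_
  ring

theorem hasDerivAt_sinh_affine (k c s : ℝ) :
    HasDerivAt (fun s => Real.sinh (k * s + c)) (k * Real.cosh (k * s + c)) s := by
  refine (hasDerivAt_affine k c s).sinh.congr_deriv ?_
  ring

theorem hasDerivAt_exp_mul (k s : ℝ) :
    HasDerivAt (fun s => Real.exp (k * s)) (k * Real.exp (k * s)) s := by
  refine (((hasDerivAt_id s).const_mul k).exp).congr_deriv ?_
  simp [mul_comm]

/-- The initial data of a function of a given class determine that class. -/
theorem IsOfClass.eq_riccatiClass {J : Set ℝ} {α : ℝ → ℝ} {T : LightlikeLineClass}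
    (hJ : IsOpenIntervalAtZero J) (hT : IsOfClass J α T) :
    T = riccatiClass (α 0) (deriv α 0 + α 0 ^ 2) := by
  have hJ0 := hJ.mem_nhds
  cases T with
  | plus =>
    obtain ⟨k, hk, c, hc, h⟩ := hT
    have hD : deriv α 0 + α 0 ^ 2 = -k ^ 2 := by
      refine riccati_of_logDeriv (P := fun s => Real.cos (k * s + c)) ?_
        (hasDerivAt_cos_affine k c 0) (hasDerivAt_sin_affine k c 0) ?_
      · filter_upwards [hJ0] with s hs
        rw [(h s hs).2, Real.tan_eq_sin_div_cos]; ring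
      · simpa using (Real.cos_pos_of_mem_Ioo (abs_lt.1 hc)).ne'
    rw [hD, riccatiClass, if_pos (by nlinarith)]
  | zeroI =>
    have hα : α =ᶠ[𝓝 0] fun _ => 0 := Filter.eventually_of_mem hJ0 hT
    rw [hα.deriv_eq, hα.self_of_nhds]
    simp [riccatiClass]
  | zeroII =>
    obtain ⟨c, hc, h⟩ := hT
    have hD : deriv α 0 + α 0 ^ 2 = 0 := by
      refine riccati_of_logDeriv (P := fun s => s + c) (P' := fun _ => 1) ?_
        ((hasDerivAt_id _).add_const c) ((hasDerivAt_const _ _).congr_deriv (by simp))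
        (by simpa using hc)
      filter_upwards [hJ0] with s hs
      rw [(h s hs).2, one_div]
    have hm : α 0 ≠ 0 := by
      rw [(h 0 hJ.2.2).2]
      exact inv_ne_zero (h 0 hJ.2.2).1
    rw [hD]
    simp [riccatiClass, hm]
  | minusI =>
    obtain ⟨k, hk, c, h⟩ := hT
    have hD : deriv α 0 + α 0 ^ 2 = k ^ 2 := by
      refine riccati_of_logDeriv (P := fun s => Real.cosh (k * s + c)) ?_
        (hasDerivAt_cosh_affine k c 0)
        (((hasDerivAt_sinh_affine k c 0).const_mul k).congr_deriv (by ring))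
        (Real.cosh_pos _).ne'
      filter_upwards [hJ0] with s hs
      rw [h s hs, Real.tanh_eq_sinh_div_cosh]; ring
    have hm : α 0 ^ 2 < k ^ 2 := by
      rw [h 0 hJ.2.2, Real.tanh_eq_sinh_div_cosh, mul_pow, div_pow, Real.sinh_sq]
      have := Real.cosh_pos (k * 0 + c)
      have h1 : (Real.cosh (k * 0 + c) ^ 2 - 1) / Real.cosh (k * 0 + c) ^ 2 < 1 := by
        rw [div_lt_one (by positivity)]; linarith
      have h2 : 0 < k ^ 2 := by positivity
      nlinarith
    have hk2 : 0 < k ^ 2 := by positivity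
    rw [hD, riccatiClass, if_neg hk2.not_gt, if_neg hk2.ne', if_pos hm]
  | minusII =>
    obtain ⟨k, hk, c, hc, h⟩ := hT
    have hs0 : Real.sinh (k * 0 + c) ≠ 0 := by
      rw [Ne, Real.sinh_eq_zero]; exact (h 0 hJ.2.2).1
    have hD : deriv α 0 + α 0 ^ 2 = k ^ 2 := by
      refine riccati_of_logDeriv (P := fun s => Real.sinh (k * s + c)) ?_
        (hasDerivAt_sinh_affine k c 0)
        (((hasDerivAt_cosh_affine k c 0).const_mul k).congr_deriv (by ring)) hs0
      filter_upwards [hJ0] with s hs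
      rw [(h s hs).2]; ring
    have hm : k ^ 2 < α 0 ^ 2 := by
      rw [(h 0 hJ.2.2).2, mul_pow, div_pow, Real.cosh_sq]
      have := pow_pos (abs_pos.2 hs0) 2
      rw [sq_abs] at this
      have h1 : 1 < (Real.sinh (k * 0 + c) ^ 2 + 1) / Real.sinh (k * 0 + c) ^ 2 := by
        rw [one_lt_div this]; linarith
      have h2 : 0 < k ^ 2 := by positivity
      nlinarith
    have hk2 : 0 < k ^ 2 := by positivity
    rw [hD, riccatiClass, if_neg hk2.not_gt, if_neg hk2.ne', if_neg hm.not_gt, if_neg hm.ne']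
  | minusIII =>
    obtain ⟨k, hk, h⟩ := hT
    obtain ⟨m, hm, h⟩ : ∃ m, m ^ 2 = k ^ 2 ∧ ∀ s ∈ J, α s = m := by
      rcases h with h | h
      · exact ⟨k, rfl, h⟩
      · exact ⟨-k, by ring, h⟩
    have hα : α =ᶠ[𝓝 0] fun _ => m := Filter.eventually_of_mem hJ0 h
    have hk2 : 0 < k ^ 2 := by positivity
    rw [hα.deriv_eq, hα.self_of_nhds, deriv_const, zero_add, hm, riccatiClass,
      if_neg hk2.not_gt, if_neg hk2.ne', if_neg (by rw [hm]; exact lt_irrefl _), if_pos hm]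

/-- In each case take a solution of `P'' = D P` with `P'(0) = α(0) P(0)`: a cosine, a constant, an
affine function, or, according to the comparison of `α(0)²` with `D > 0`, `cosh`, an exponential or
`sinh`. Then `α P = P'` on `J`. Since `P` and `P'` have no common zero, `P` has no zero on `J`; this
gives both the formula for `α` and the absence of poles. -/
theorem isOfClass_riccatiClass {J : Set ℝ} {α : ℝ → ℝ} {D : ℝ} (hJ : IsOpenIntervalAtZero J)
    (hα : AnalyticOnNhd ℝ α J) (hD : ∀ᶠ s in 𝓝 (0 : ℝ), deriv α s + α s ^ 2 = D) :
    IsOfClass J α (riccatiClass (α 0) D) := by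
  unfold riccatiClass
  split_ifs with h1 h2 h3 h4 h5
  · set k := √(-D) with hkdef
    have hk : 0 < k := Real.sqrt_pos.2 (by linarith)
    have hkD : -k ^ 2 = D := by rw [hkdef, Real.sq_sqrt (by linarith)]; ring
    -- The phase is fixed by `-k tan c = α 0`.
    set c := Real.arctan (-α 0 / k) with hcdef
    have hc : |c| < Real.pi / 2 :=
      abs_lt.2 ⟨Real.neg_pi_div_two_lt_arctan _, Real.arctan_lt_pi_div_two _⟩
    have hcos : 0 < Real.cos c := Real.cos_arctan_pos _
    have hP := mul_eq_of_riccati (P := fun s => Real.cos (k * s + c))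
      (P' := fun s => -k * Real.sin (k * s + c)) hJ hα hD
      (Real.analyticOnNhd_cos.comp (analyticOnNhd_affine k c) (Set.mapsTo_univ _ _))
      (analyticOnNhd_const.mul
        (Real.analyticOnNhd_sin.comp (analyticOnNhd_affine k c) (Set.mapsTo_univ _ _)))
      (hasDerivAt_cos_affine k c) (by rw [← hkD]; exact hasDerivAt_sin_affine k c) (by
        have := Real.tan_arctan (-α 0 / k)
        rw [← hcdef, Real.tan_eq_sin_div_cos, div_eq_div_iff hcos.ne' hk.ne'] at this
        simp only [mul_zero, zero_add]
        linear_combination this)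
    have hne : ∀ s ∈ J, Real.cos (k * s + c) ≠ 0 := by
      intro s hs h0
      have h := hP s hs
      rw [h0, mul_zero] at h
      have h' : Real.sin (k * s + c) = 0 := by
        rcases mul_eq_zero.1 h.symm with h | h
        · linarith
        · exact h
      have := Real.sin_sq_add_cos_sq (k * s + c)
      rw [h0, h'] at this
      norm_num at this
    refine ⟨k, hk, c, hc, fun s hs => ⟨?_, ?_⟩⟩
    -- If the angle had left `(-π/2, π/2)` at `s`, then between `0` and `s`, hence in `J`, there
    -- would be a point with angle exactly `±π/2`, a zero of the cosine.
    · rw [abs_lt] at hc ⊢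
      by_contra hcon
      obtain ⟨t, ht, htJ⟩ : ∃ t ∈ J, Real.cos (k * t + c) = 0 := by
        by_cases hle : -(Real.pi / 2) < k * s + c
        · have hge : Real.pi / 2 ≤ k * s + c := not_lt.1 fun h => hcon ⟨hle, h⟩
          refine ⟨(Real.pi / 2 - c) / k, hJ.2.1.out hJ.2.2 hs
            ⟨div_nonneg (by linarith [hc.2]) hk.le, ?_⟩, ?_⟩
          · rw [div_le_iff₀ hk]; linarith
          · rw [mul_div_cancel₀ _ hk.ne', sub_add_cancel, Real.cos_pi_div_two]
        · rw [not_lt] at hle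
          refine ⟨(-(Real.pi / 2) - c) / k, hJ.2.1.out hs hJ.2.2
            ⟨?_, div_nonpos_of_nonpos_of_nonneg (by linarith [hc.1]) hk.le⟩, ?_⟩
          · rw [le_div_iff₀ hk]; linarith
          · rw [mul_div_cancel₀ _ hk.ne', sub_add_cancel, Real.cos_neg, Real.cos_pi_div_two]
      exact hne t ht htJ
    · rw [Real.tan_eq_sin_div_cos, ← neg_div, ← mul_div_assoc, eq_div_iff (hne s hs), hP s hs]
      ring
  · intro s hs
    have := mul_eq_of_riccati (P := fun _ => 1) (P' := fun _ => 0) hJ hα hD analyticOnNhd_const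
      analyticOnNhd_const (fun s => hasDerivAt_const _ _)
      (fun s => (hasDerivAt_const _ _).congr_deriv (by simp [h2])) (by simp [h3]) s hs
    simpa using this
  · have hP := mul_eq_of_riccati (P := fun s => s + (α 0)⁻¹) (P' := fun _ => 1) hJ hα hD
      (fun _ _ => analyticAt_id.add analyticAt_const)
      analyticOnNhd_const (fun s => (hasDerivAt_id s).add_const _)
      (fun s => (hasDerivAt_const _ _).congr_deriv (by simp [h2])) (by simp [h3])
    refine ⟨(α 0)⁻¹, inv_ne_zero h3, fun s hs => ?_⟩
    have h := hP s hs
    exact ⟨right_ne_zero_of_mul (h ▸ one_ne_zero), eq_inv_of_mul_eq_one_left h⟩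
  all_goals
    have hDpos : 0 < D := lt_of_le_of_ne (not_lt.1 h1) (Ne.symm h2)
    obtain ⟨k, hk, hkD⟩ : ∃ k > 0, k ^ 2 = D :=
      ⟨√D, Real.sqrt_pos.2 hDpos, Real.sq_sqrt hDpos.le⟩
  · have hr : α 0 / k ∈ Set.Ioo (-1 : ℝ) 1 := by
      rw [← hkD] at h4
      have := abs_lt.1 (abs_lt_of_sq_lt_sq h4 hk.le)
      rw [Set.mem_Ioo, lt_div_iff₀ hk, div_lt_one hk]
      exact ⟨by linarith [this.1], this.2⟩
    set c := Real.artanh (α 0 / k) with hcdef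
    have hP := mul_eq_of_riccati (P := fun s => Real.cosh (k * s + c))
      (P' := fun s => k * Real.sinh (k * s + c)) hJ hα hD
      (Real.analyticOnNhd_cosh.comp (analyticOnNhd_affine k c) (Set.mapsTo_univ _ _))
      (analyticOnNhd_const.mul
        (Real.analyticOnNhd_sinh.comp (analyticOnNhd_affine k c) (Set.mapsTo_univ _ _)))
      (hasDerivAt_cosh_affine k c)
      (fun s => ((hasDerivAt_sinh_affine k c s).const_mul k).congr_deriv (by rw [← hkD]; ring)) (by
        have := Real.tanh_artanh hr
        rw [← hcdef, Real.tanh_eq_sinh_div_cosh,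
          div_eq_div_iff (Real.cosh_pos _).ne' hk.ne'] at this
        simp only [mul_zero, zero_add]
        linear_combination -this)
    refine ⟨k, hk, c, fun s hs => ?_⟩
    rw [Real.tanh_eq_sinh_div_cosh, ← mul_div_assoc, eq_div_iff (Real.cosh_pos _).ne']
    exact hP s hs
  -- With `e = α 0` and `e² = D`, the function `P = exp (e s)` has `P' = e P`, which makes `α`
  -- constant.
  · obtain ⟨e, he, hαe⟩ : ∃ e : ℝ, (e = k ∨ e = -k) ∧ α 0 = e := by
      rw [← hkD] at h5
      exact ⟨α 0, sq_eq_sq_iff_eq_or_eq_neg.1 h5, rfl⟩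
    have he2 : e * e = D := by rcases he with rfl | rfl <;> rw [← hkD] <;> ring
    have hP := mul_eq_of_riccati (P := fun s => Real.exp (e * s))
      (P' := fun s => e * Real.exp (e * s)) hJ hα hD
      (fun s _ => (analyticAt_const.mul analyticAt_id).rexp)
      (fun s _ => analyticAt_const.mul (analyticAt_const.mul analyticAt_id).rexp)
      (hasDerivAt_exp_mul e)
      (fun s => ((hasDerivAt_exp_mul e s).const_mul e).congr_deriv (by rw [← he2]; ring))
      (by rw [hαe])
    have hconst : ∀ s ∈ J, α s = e := fun s hs =>
      mul_right_cancel₀ (Real.exp_pos (e * s)).ne' (hP s hs)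
    rcases he with rfl | rfl
    · exact ⟨e, hk, Or.inl hconst⟩
    · exact ⟨k, hk, Or.inr hconst⟩
  · have hlt : k ^ 2 < α 0 ^ 2 := by
      rw [hkD]; exact lt_of_le_of_ne (not_lt.1 h4) (Ne.symm h5)
    have hm0 : α 0 ≠ 0 := by
      intro h
      rw [h] at hlt
      nlinarith
    have hr : k / α 0 ∈ Set.Ioo (-1 : ℝ) 1 := by
      rw [Set.mem_Ioo, ← abs_lt, ← sq_lt_one_iff_abs_lt_one, div_pow, div_lt_one (by positivity)]
      exact hlt
    -- The phase is fixed by `k coth c = α 0`, that is, `tanh c = k / α 0`, which is possible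
    -- because `k < |α 0|`.
    set c := Real.artanh (k / α 0) with hcdef
    have htanh := Real.tanh_artanh hr
    rw [← hcdef, Real.tanh_eq_sinh_div_cosh,
          div_eq_div_iff (Real.cosh_pos _).ne' hm0] at htanh
    have hP := mul_eq_of_riccati (P := fun s => Real.sinh (k * s + c))
      (P' := fun s => k * Real.cosh (k * s + c)) hJ hα hD
      (Real.analyticOnNhd_sinh.comp (analyticOnNhd_affine k c) (Set.mapsTo_univ _ _))
      (analyticOnNhd_const.mul
        (Real.analyticOnNhd_cosh.comp (analyticOnNhd_affine k c) (Set.mapsTo_univ _ _)))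
      (hasDerivAt_sinh_affine k c)
      (fun s => ((hasDerivAt_cosh_affine k c s).const_mul k).congr_deriv (by rw [← hkD]; ring)) (by
        simp only [mul_zero, zero_add]
        linear_combination htanh)
    have hne : ∀ s ∈ J, Real.sinh (k * s + c) ≠ 0 := fun s hs =>
      right_ne_zero_of_mul (hP s hs ▸ (mul_pos hk (Real.cosh_pos _)).ne')
    have hne' : ∀ s ∈ J, k * s + c ≠ 0 := fun s hs h => hne s hs (by rw [h, Real.sinh_zero])
    refine ⟨k, hk, c, by simpa using hne' 0 hJ.2.2, fun s hs => ⟨hne' s hs, ?_⟩⟩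
    rw [← mul_div_assoc, eq_div_iff (hne s hs)]
    exact hP s hs

/-- An analytic solution of the Riccati equation belongs to exactly one class, which its initial
data determine. -/
theorem hasExactClass_of_riccati {J : Set ℝ} {α : ℝ → ℝ} {D : ℝ} (hJ : IsOpenIntervalAtZero J)
    (hα : AnalyticOnNhd ℝ α J) (hD : ∀ᶠ s in 𝓝 (0 : ℝ), deriv α s + α s ^ 2 = D) :
    HasExactClass J α (riccatiClass (α 0) D) := by
  intro T
  constructor
  · intro h
    rw [← hD.self_of_nhds]
    exact h.eq_riccatiClass hJ
  · rintro rfl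
    exact isOfClass_riccatiClass hJ hα hD

/-! ### Rescaling of coordinates -/

/-- The chain rule for diagonal maps. With signs as constants it serves both the normalizing
reflections and the parity relations. -/
theorem pd1_scale {f k : ℝ × ℝ → ℝ} {c l m : ℝ} {p : ℝ × ℝ}
    (hk : AnalyticAt ℝ k (l * p.1, m * p.2))
    (hf : f =ᶠ[𝓝 p] fun q => c * k (l * q.1, m * q.2)) :
    pd1 f p = c * l * pd1 k (l * p.1, m * p.2) := by
  obtain ⟨x, y⟩ := p
  have hkd := hk.differentiableAt.hasFDerivAt
  have hin : HasFDerivAt (fun q : ℝ × ℝ => (l * q.1, m * q.2))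
      ((l • ContinuousLinearMap.fst ℝ ℝ ℝ).prod (m • ContinuousLinearMap.snd ℝ ℝ ℝ)) (x, y) :=
    (hasFDerivAt_fst.const_mul l).prodMk (hasFDerivAt_snd.const_mul m)
  have h := (hkd.comp (x, y) hin).const_mul c
  rw [pd1, hf.fderiv_eq]
  refine (congrArg (fun T : ℝ × ℝ →L[ℝ] ℝ => T (1, 0)) h.fderiv).trans ?_
  have e : fderiv ℝ k (l * x, m * y) (l, 0) = l * fderiv ℝ k (l * x, m * y) (1, 0) := by
    have := (fderiv ℝ k (l * x, m * y)).map_smul l (1, 0)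
    simpa using this
  simp [pd1, e, mul_assoc]

theorem pd2_scale {f k : ℝ × ℝ → ℝ} {c l m : ℝ} {p : ℝ × ℝ}
    (hk : AnalyticAt ℝ k (l * p.1, m * p.2))
    (hf : f =ᶠ[𝓝 p] fun q => c * k (l * q.1, m * q.2)) :
    pd2 f p = c * m * pd2 k (l * p.1, m * p.2) := by
  obtain ⟨x, y⟩ := p
  have hkd := hk.differentiableAt.hasFDerivAt
  have hin : HasFDerivAt (fun q : ℝ × ℝ => (l * q.1, m * q.2))
      ((l • ContinuousLinearMap.fst ℝ ℝ ℝ).prod (m • ContinuousLinearMap.snd ℝ ℝ ℝ)) (x, y) :=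
    (hasFDerivAt_fst.const_mul l).prodMk (hasFDerivAt_snd.const_mul m)
  have h := (hkd.comp (x, y) hin).const_mul c
  rw [pd2, hf.fderiv_eq]
  refine (congrArg (fun T : ℝ × ℝ →L[ℝ] ℝ => T (0, 1)) h.fderiv).trans ?_
  have e : fderiv ℝ k (l * x, m * y) (0, m) = m * fderiv ℝ k (l * x, m * y) (0, 1) := by
    have := (fderiv ℝ k (l * x, m * y)).map_smul m (0, 1)
    simpa using this
  simp [pd2, e, mul_assoc]

theorem continuous_scale (l m : ℝ) : Continuous fun q : ℝ × ℝ => (l * q.1, m * q.2) := by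
  fun_prop

theorem eventually_scale {k : ℝ × ℝ → ℝ} {l m : ℝ} {p : ℝ × ℝ}
    (hk : AnalyticAt ℝ k (l * p.1, m * p.2)) :
    ∀ᶠ q in 𝓝 p, AnalyticAt ℝ k (l * q.1, m * q.2) :=
  ((continuous_scale l m).tendsto p).eventually hk.eventually_analyticAt

theorem pd1_scale_eventually {f k : ℝ × ℝ → ℝ} {c l m : ℝ} {p : ℝ × ℝ}
    (hk : AnalyticAt ℝ k (l * p.1, m * p.2))
    (hf : f =ᶠ[𝓝 p] fun q => c * k (l * q.1, m * q.2)) :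
    pd1 f =ᶠ[𝓝 p] fun q => c * l * pd1 k (l * q.1, m * q.2) := by
  filter_upwards [hf.eventuallyEq_nhds, eventually_scale hk] with q h1 h2
  exact pd1_scale h2 h1

theorem pd2_scale_eventually {f k : ℝ × ℝ → ℝ} {c l m : ℝ} {p : ℝ × ℝ}
    (hk : AnalyticAt ℝ k (l * p.1, m * p.2))
    (hf : f =ᶠ[𝓝 p] fun q => c * k (l * q.1, m * q.2)) :
    pd2 f =ᶠ[𝓝 p] fun q => c * m * pd2 k (l * q.1, m * q.2) := by
  filter_upwards [hf.eventuallyEq_nhds, eventually_scale hk] with q h1 h2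
  exact pd2_scale h2 h1

theorem AnalyticAt.scale {k : ℝ × ℝ → ℝ} {l m : ℝ} {p : ℝ × ℝ} (c : ℝ)
    (hk : AnalyticAt ℝ k (l * p.1, m * p.2)) :
    AnalyticAt ℝ (fun q : ℝ × ℝ => c * k (l * q.1, m * q.2)) p :=
  analyticAt_const.mul (hk.comp₂ (analyticAt_const.mul analyticAt_fst)
    (analyticAt_const.mul analyticAt_snd))

/-! ### Approximation functions of graphs -/

/-- As `a` is its own inverse, the reflected surface is the graph of `a k(x, b y)`. -/
theorem hasApproximationFunction_graphOverXY {k : ℝ × ℝ → ℝ} {U : Set (ℝ × ℝ)} {J : Set ℝ}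
    {a b : ℝ} (hU : IsOpen U) (hk : AnalyticOnNhd ℝ k U) (ha : a * a = 1)
    (hJU : ∀ s ∈ J, (0, b * s) ∈ U) (hline : ∀ s ∈ J, k (0, b * s) = a * s)
    (htan : ∀ s ∈ J, pd1 k (0, b * s) = 0) :
    HasApproximationFunction (reflectTY a b (graphOverXY k U)) J
      (fun s => a * pd1 (pd1 k) (0, b * s)) := by
  intro s hs
  have h1 : ((1 : ℝ) * (0, s).1, b * (0, s).2) = (0, b * s) := by simp
  have hks : AnalyticAt ℝ k (1 * ((0 : ℝ), s).1, b * ((0 : ℝ), s).2) := by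
    rw [h1]; exact hk _ (hJU s hs)
  have hsolve : ∀ t u : ℝ, a * t = u ↔ t = a * u := by
    intro t u
    constructor
    · rintro rfl; rw [← mul_assoc, ha, one_mul]
    · rintro rfl; rw [← mul_assoc, ha, one_mul]
  refine ⟨⟨hJU s hs, (hline s hs).symm⟩, fun p => a * k (1 * p.1, b * p.2),
    hks.scale a, ?_, ?_, ?_⟩
  · have hc : Continuous fun p : ℝ × ℝ × ℝ => (p.2.1, b * p.2.2) := by fun_prop
    filter_upwards [(hU.preimage hc).mem_nhds (x := (s, 0, s)) (hJU s hs)] with p hp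
    rw [one_mul, ← hsolve]
    exact ⟨fun h => h.2, fun h => ⟨hp, h⟩⟩
  · rw [pd1_scale hks Filter.EventuallyEq.rfl, h1, htan s hs, mul_zero]
  · have h2 := pd1_scale_eventually hks Filter.EventuallyEq.rfl (c := a)
    rw [pd1_scale (by rw [h1]; exact (hk _ (hJU s hs)).pd1) h2, h1]
    ring

/-- An analytic surface `y = H(t, x)` that contains a lightlike segment and is tangent to a
lightlike plane there is locally an analytic graph `t = f(x, y)`. -/
theorem exists_inverse_graph {H : ℝ × ℝ → ℝ} {s : ℝ} (hH : AnalyticAt ℝ H (s, 0))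
    (h0 : H (s, 0) = s) (h1 : pd1 H (s, 0) = 1) (h2 : pd2 H (s, 0) = 0) :
    ∃ f : ℝ × ℝ → ℝ, AnalyticAt ℝ f (0, s) ∧
      (∀ᶠ p : ℝ × ℝ × ℝ in 𝓝 (s, 0, s), p.2.2 = H (p.1, p.2.1) ↔ p.1 = f (p.2.1, p.2.2)) ∧
      pd1 f (0, s) = 0 ∧ pd1 (pd1 f) (0, s) = -pd2 (pd2 H) (s, 0) := by
  -- Solving `y = H(t, x)` for `t` amounts to inverting `(t, x) ↦ (x, H(t, x))`, whose differential
  -- at `(s, 0)` is the coordinate swap.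
  let Φ : ℝ × ℝ → ℝ × ℝ := fun q => (q.2, H q)
  have hΦ : AnalyticAt ℝ Φ (s, 0) := analyticAt_snd.prod hH
  have hdH : fderiv ℝ H (s, 0) = ContinuousLinearMap.fst ℝ ℝ ℝ := by
    ext
    · simpa [pd1] using h1
    · simpa [pd2] using h2
  have hΦd : HasFDerivAt Φ
      ((ContinuousLinearEquiv.prodComm ℝ ℝ ℝ : (ℝ × ℝ) ≃L[ℝ] (ℝ × ℝ)) : ℝ × ℝ →L[ℝ] ℝ × ℝ)
      (s, 0) := by
    have := (hasFDerivAt_snd (𝕜 := ℝ) (p := ((s, 0) : ℝ × ℝ))).prodMk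
      hH.differentiableAt.hasFDerivAt
    rw [hdH] at this
    exact this
  -- In `WithTop ℕ∞` the exponent `⊤` is the analytic class, so the local inverse is analytic and
  -- not merely smooth.
  have hΦc : ContDiffAt ℝ ⊤ Φ (s, 0) := hΦ.contDiffAt
  have hne : (⊤ : WithTop ℕ∞) ≠ 0 := by simp
  have hstrict := hΦc.hasStrictFDerivAt' hΦd hne
  let Ψ : ℝ × ℝ → ℝ × ℝ := hΦc.localInverse hΦd hne
  have hΦ0 : Φ (s, 0) = (0, s) := by simp [Φ, h0]
  have hΨ : AnalyticAt ℝ Ψ (0, s) := by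
    have := hΦc.to_localInverse hΦd hne
    rw [hΦ0] at this
    exact this.analyticAt
  have hleft : ∀ᶠ q in 𝓝 ((s, 0) : ℝ × ℝ), Ψ (Φ q) = q := hstrict.eventually_left_inverse
  have hright : ∀ᶠ r in 𝓝 ((0, s) : ℝ × ℝ), Φ (Ψ r) = r := by
    have := hstrict.eventually_right_inverse
    rwa [hΦ0] at this
  have hΨ0 : Ψ (0, s) = (s, 0) := by
    rw [← hΦ0]; exact hleft.self_of_nhds
  let f : ℝ × ℝ → ℝ := fun r => (Ψ r).1
  have hf : AnalyticAt ℝ f (0, s) := analyticAt_fst.comp hΨ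
  have hf0 : f (0, s) = s := by simp [f, hΨ0]
  have hfH : ∀ᶠ r in 𝓝 ((0, s) : ℝ × ℝ), H (f r, r.1) = r.2 := by
    filter_upwards [hright] with r hr
    have hr1 : (Ψ r).2 = r.1 := congrArg Prod.fst hr
    have hr2 : H (Ψ r) = r.2 := congrArg Prod.snd hr
    rw [← hr1]
    exact hr2
  have hcurve : Filter.Tendsto (fun x : ℝ => (x, s)) (𝓝 0) (𝓝 (0, s)) :=
    (Continuous.prodMk_left s).tendsto 0
  have hcurve' : Filter.Tendsto (fun x : ℝ => (f (x, s), x)) (𝓝 0) (𝓝 (s, 0)) := by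
    have h : ContinuousAt (fun x : ℝ => f (x, s)) 0 :=
      ContinuousAt.comp (g := f) (f := fun x : ℝ => (x, s)) hf.continuousAt
        (Continuous.prodMk_left s).continuousAt
    have := h.prodMk (continuousAt_id (x := (0 : ℝ)))
    rw [ContinuousAt] at this
    simpa [hf0] using this
  -- the chain rule along `x ↦ (f (x, s), x)`
  have hchain : ∀ (F : ℝ × ℝ → ℝ) (x : ℝ), AnalyticAt ℝ f (x, s) → AnalyticAt ℝ F (f (x, s), x) →
      HasDerivAt (fun x => F (f (x, s), x))
        (pd1 F (f (x, s), x) * pd1 f (x, s) + pd2 F (f (x, s), x)) x := by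
    intro F x hfx hFx
    have h := HasFDerivAt.comp_hasDerivAt (f := fun x => (f (x, s), x)) x
      hFx.differentiableAt.hasFDerivAt
      (hfx.hasDerivAt_pd1.prodMk (hasDerivAt_id x))
    refine h.congr_deriv ?_
    have : ((pd1 f (x, s), 1) : ℝ × ℝ) = pd1 f (x, s) • (1, 0) + (0, 1) := by simp
    rw [this, map_add, map_smul, smul_eq_mul, mul_comm]
    rfl
  -- This is the `x`-derivative of `H (f (x, s), x) = s`. Differentiated again at `x = 0`, where
  -- `f_x = 0` and `H_t = 1`, it leaves `f_xx + H_xx = 0`.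
  have hd1 : ∀ᶠ x in 𝓝 (0 : ℝ),
      pd1 H (f (x, s), x) * pd1 f (x, s) + pd2 H (f (x, s), x) = 0 := by
    filter_upwards [hcurve.eventually hf.eventually_analyticAt,
      hcurve'.eventually hH.eventually_analyticAt, (hcurve.eventually hfH).eventually_nhds]
      with x hfx hHx hx
    exact (hchain H x hfx hHx).unique ((hasDerivAt_const x s).congr_of_eventuallyEq hx)
  have hf1 : pd1 f (0, s) = 0 := by
    have := hd1.self_of_nhds
    rw [hf0, h1, h2] at this
    linarith
  have hd2 : pd1 (pd1 f) (0, s) = -pd2 (pd2 H) (s, 0) := by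
    have hA := hchain (pd1 H) 0 hf (by rw [hf0]; exact hH.pd1)
    have hB := hchain (pd2 H) 0 hf (by rw [hf0]; exact hH.pd2)
    have hC := (hA.mul hf.pd1.hasDerivAt_pd1).add hB
    have := hC.unique ((hasDerivAt_const (0 : ℝ) (0 : ℝ)).congr_of_eventuallyEq hd1)
    rw [hf0, hf1, h1] at this
    linarith
  refine ⟨f, hf, ?_, hf1, hd2⟩
  have hp1 : Filter.Tendsto (fun p : ℝ × ℝ × ℝ => (p.1, p.2.1)) (𝓝 (s, 0, s)) (𝓝 (s, 0)) :=
    (by fun_prop : Continuous fun p : ℝ × ℝ × ℝ => (p.1, p.2.1)).tendsto (s, 0, s)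
  have hp2 : Filter.Tendsto (fun p : ℝ × ℝ × ℝ => p.2) (𝓝 (s, 0, s)) (𝓝 (0, s)) :=
    continuous_snd.tendsto (s, 0, s)
  filter_upwards [hp1.eventually hleft, hp2.eventually hfH] with p hl hr
  constructor
  · intro h
    have h' : Φ (p.1, p.2.1) = (p.2.1, p.2.2) := by simp [Φ, ← h]
    rw [h'] at hl
    simp [f, hl]
  · intro h
    rw [h]
    exact hr.symm

/-- The reflected surface is `y = a h(b t, x)`. It has slope one along the segment, so it can be
rewritten as a graph over the `(x, y)`-plane; this inversion produces the minus sign. -/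
theorem hasApproximationFunction_graphOverTX {h : ℝ × ℝ → ℝ} {V : Set (ℝ × ℝ)} {J : Set ℝ}
    {a b : ℝ} (hV : IsOpen V) (hh : AnalyticOnNhd ℝ h V) (hJ : IsOpen J) (ha : a * a = 1)
    (hJV : ∀ s ∈ J, (b * s, 0) ∈ V) (hline : ∀ s ∈ J, h (b * s, 0) = a * s)
    (htan : ∀ s ∈ J, pd2 h (b * s, 0) = 0) :
    HasApproximationFunction (reflectTY b a (graphOverTX h V)) J
      (fun s => -a * pd2 (pd2 h) (b * s, 0)) := by
  intro s hs
  have e1 : (b * (s, (0 : ℝ)).1, (1 : ℝ) * (s, (0 : ℝ)).2) = (b * s, 0) := by simp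
  have hhs : AnalyticAt ℝ h (b * (s, (0 : ℝ)).1, (1 : ℝ) * (s, (0 : ℝ)).2) := by
    rw [e1]; exact hh _ (hJV s hs)
  have hH : AnalyticAt ℝ (fun q : ℝ × ℝ => a * h (b * q.1, 1 * q.2)) (s, 0) := hhs.scale a
  have hHline : ∀ t ∈ J, a * h (b * t, 1 * 0) = t := by
    intro t ht
    rw [mul_zero, hline t ht, ← mul_assoc, ha, one_mul]
  obtain ⟨f, hf, hfS, hf1, hf2⟩ := exists_inverse_graph hH (hHline s hs) (by
      refine hH.hasDerivAt_pd1.unique ?_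
      exact (hasDerivAt_id s).congr_of_eventuallyEq
        (Filter.eventually_of_mem (hJ.mem_nhds hs) hHline))
    (by rw [pd2_scale hhs Filter.EventuallyEq.rfl, e1, htan s hs, mul_zero])
  have hsolve : ∀ t u : ℝ, a * t = u ↔ t = a * u := by
    intro t u
    constructor
    · rintro rfl; rw [← mul_assoc, ha, one_mul]
    · rintro rfl; rw [← mul_assoc, ha, one_mul]
  refine ⟨⟨hJV s hs, (hline s hs).symm⟩, f, hf, ?_, hf1, ?_⟩
  · have hc : Continuous fun p : ℝ × ℝ × ℝ => (b * p.1, p.2.1) := by fun_prop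
    filter_upwards [(hV.preimage hc).mem_nhds (x := (s, 0, s)) (hJV s hs), hfS] with p hp hpf
    rw [← hpf, one_mul, ← hsolve]
    exact ⟨fun h => h.2, fun h => ⟨hp, h⟩⟩
  · rw [hf2, pd2_scale (by rw [e1]; exact (hh _ (hJV s hs)).pd2)
      (pd2_scale_eventually hhs Filter.EventuallyEq.rfl), e1]
    ring

/-! ### Germs of zero mean curvature graphs along a lightlike line -/

theorem IsOpenIntervalAtZero.eqOn {J : Set ℝ} {α β : ℝ → ℝ} (hJ : IsOpenIntervalAtZero J)
    (hα : AnalyticOnNhd ℝ α J) (hβ : AnalyticOnNhd ℝ β J) (h : α =ᶠ[𝓝 0] β) :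
    ∀ s ∈ J, α s = β s :=
  hα.eqOn_of_preconnected_of_eventuallyEq hβ hJ.isPreconnected hJ.2.2 h

/-- The relation makes sense on `J ∩ -J`, again an open interval around `0`, so it propagates there
from its germ. -/
theorem IsOpenIntervalAtZero.odd {J : Set ℝ} {α : ℝ → ℝ} (hJ : IsOpenIntervalAtZero J)
    (hα : AnalyticOnNhd ℝ α J) (h : ∀ᶠ s in 𝓝 (0 : ℝ), α (-s) = -α s) :
    ∀ s ∈ J, -s ∈ J → α (-s) = -α s := by
  have hJ' : IsOpenIntervalAtZero (-J) := by
    refine ⟨hJ.1.neg, ⟨fun x hx y hy z hz => ?_⟩, by simpa using hJ.2.2⟩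
    exact hJ.2.1.out hy hx ⟨neg_le_neg hz.2, neg_le_neg hz.1⟩
  intro s hs hs'
  refine (hJ.inter hJ').eqOn (α := fun s => α (-s)) (β := fun s => -α s) ?_ ?_ h s ⟨hs, hs'⟩
  · exact fun t ht => AnalyticAt.comp (g := α) (f := fun s : ℝ => -s) (hα _ ht.2) analyticAt_id.neg
  · exact fun t ht => (hα t ht.1).neg

/-- The germ at the origin of a zero mean curvature graph `t = k(x, y)` that contains a segment
of the lightlike line `{(ε y, 0, y)}`, to which it is tangent in the sense `k_x = 0`. -/
structure LightlikeLineGerm (k : ℝ × ℝ → ℝ) (ε D : ℝ) : Prop where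
  analytic : AnalyticAt ℝ k (0, 0)
  zmc : ∀ᶠ q in 𝓝 (0, 0), zmcExpr k q = 0
  sq : ε ^ 2 = 1
  line : ∀ᶠ y in 𝓝 (0 : ℝ), k (0, y) = ε * y
  tangent : ∀ᶠ y in 𝓝 (0 : ℝ), pd1 k (0, y) = 0
  riccati : ∀ᶠ y in 𝓝 (0 : ℝ), pd2 (pd1 (pd1 k)) (0, y) + ε * pd1 (pd1 k) (0, y) ^ 2 = D

/-- With `k_x = 0`, the condition `B = 0` reads `k_y² = 1`, and `B_x = -2 (k_x k_xx + k_y k_xy)`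
reduces to `-2 k_y k_xy`, so `k_xy = 0`. These are the initial data of the linear system along the
axis; integrating `k_y = ε` from `k(0, 0) = 0` then gives the segment. -/
theorem exists_lightlikeLineGerm {k : ℝ × ℝ → ℝ} (hk : AnalyticAt ℝ k (0, 0))
    (hE : ∀ᶠ q in 𝓝 (0, 0), zmcExpr k q = 0) (hk0 : k (0, 0) = 0) (hB : causalB k (0, 0) = 0)
    (hB1 : pd1 (causalB k) (0, 0) = 0) (hQ0 : pd1 k (0, 0) = 0) :
    ∃ ε ∈ ({1, -1} : Set ℝ), ∃ D, LightlikeLineGerm k ε D := by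
  have hε : pd2 k (0, 0) ^ 2 = 1 := by
    rw [causalB, hQ0] at hB; linarith
  refine ⟨pd2 k (0, 0), mul_self_eq_one_iff.1 ((sq _).symm.trans hε), ?_⟩
  have hS0 : pd2 (pd1 k) (0, 0) = 0 := by
    have hP := hk.pd2.hasDerivAt_pd1
    rw [hk.pd1_pd2_comm] at hP
    have hBd := ((hk.pd1.hasDerivAt_pd1.pow 2).const_sub 1).sub (hP.pow 2)
    have han : AnalyticAt ℝ (causalB k) (0, 0) :=
      (analyticAt_const.sub (hk.pd1.pow 2)).sub (hk.pd2.pow 2)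
    have := hBd.unique han.hasDerivAt_pd1
    rw [hB1, hQ0] at this
    have h2 : pd2 k (0, 0) ≠ 0 := by
      intro h; rw [h] at hε; norm_num at hε
    have h3 : pd2 k (0, 0) * pd2 (pd1 k) (0, 0) = 0 := by
      norm_num at this
      rcases this with h | h <;> simp [h]
    exact (mul_eq_zero.1 h3).resolve_left h2
  have hl := zmc_contains_lightlike_line hk hE hε hQ0 rfl hS0
  obtain ⟨D, hD⟩ := zmc_riccati hk hE hε hl
  refine ⟨D, hk, hE, hε, ?_, hl.mono fun _ h => h.1, hD⟩
  obtain ⟨δ, hδ, hb⟩ := Metric.eventually_nhds_iff_ball.1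
    (hl.and (tendsto_mk_zero_left.eventually hk.eventually_analyticAt))
  filter_upwards [Metric.ball_mem_nhds (0 : ℝ) hδ] with y hy
  have hd : ∀ z ∈ Metric.ball (0 : ℝ) δ,
      HasDerivAt (fun y => k (0, y) - pd2 k (0, 0) * y) 0 z := by
    intro z hz
    refine ((hb z hz).2.hasDerivAt_pd2.sub ((hasDerivAt_id z).const_mul _)).congr_deriv ?_
    rw [(hb z hz).1.2.1]; ring
  have := Metric.isOpen_ball.is_const_of_deriv_eq_zero (convex_ball (0 : ℝ) δ).isPreconnected
    (fun z hz => (hd z hz).differentiableAt.differentiableWithinAt) (fun z hz => (hd z hz).deriv)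
    hy (Metric.mem_ball_self hδ)
  simp only [hk0, mul_zero, sub_zero] at this
  linarith

theorem mul_self_of_mem_signs {a : ℝ} (ha : a ∈ ({1, -1} : Set ℝ)) : a * a = 1 := by
  rcases ha with rfl | rfl <;> norm_num

theorem tendsto_const_mul_zero (b : ℝ) : Filter.Tendsto (fun s : ℝ => b * s) (𝓝 0) (𝓝 0) := by
  have : Continuous fun s : ℝ => b * s := by fun_prop
  simpa using this.tendsto 0

/-- The approximation function of a graph along its lightlike segment. -/
theorem LightlikeLineGerm.hasApproximationFunction {k : ℝ × ℝ → ℝ} {ε D a b : ℝ}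
    {U : Set (ℝ × ℝ)} {J : Set ℝ} (hg : LightlikeLineGerm k ε D) (hU : IsOpen U)
    (hk : AnalyticOnNhd ℝ k U) (ha : a * a = 1) (hb : b * b = 1) (hab : a * b = ε)
    (hJ : IsOpenIntervalAtZero J) (hJU : ∀ s ∈ J, (0, b * s) ∈ U) :
    HasApproximationFunction (reflectTY a b (graphOverXY k U)) J
        (fun s => a * pd1 (pd1 k) (0, b * s)) ∧
      AnalyticOnNhd ℝ (fun s => a * pd1 (pd1 k) (0, b * s)) J ∧
      ∀ᶠ s in 𝓝 (0 : ℝ), deriv (fun s => a * pd1 (pd1 k) (0, b * s)) s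
        + (a * pd1 (pd1 k) (0, b * s)) ^ 2 = ε * D := by
  have hres : ∀ {f : ℝ × ℝ → ℝ}, AnalyticOnNhd ℝ f U → AnalyticOnNhd ℝ (fun s => f (0, b * s)) J :=
    fun {f} hf s hs => AnalyticAt.comp₂ (h := f) (f := fun _ : ℝ => (0 : ℝ))
      (g := fun s : ℝ => b * s) (hf _ (hJU s hs)) analyticAt_const
      (analyticAt_const.mul analyticAt_id)
  refine ⟨hasApproximationFunction_graphOverXY hU hk ha hJU ?_ ?_, ?_, ?_⟩
  · refine hJ.eqOn (hres hk) (fun s _ => analyticAt_const.mul analyticAt_id) ?_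
    filter_upwards [(tendsto_const_mul_zero b).eventually hg.line] with s hs
    rw [hs, ← hab]
    linear_combination a * s * hb
  · exact hJ.eqOn (hres fun p hp => (hk p hp).pd1) (fun s _ => analyticAt_const)
      ((tendsto_const_mul_zero b).eventually hg.tangent)
  · exact fun s hs => analyticAt_const.mul (hres (fun p hp => (hk p hp).pd1.pd1) s hs)
  · filter_upwards [(tendsto_const_mul_zero b).eventually hg.riccati,
      (tendsto_const_mul_zero b).eventually
        (tendsto_mk_zero_left.eventually hg.analytic.eventually_analyticAt)] with s hs hks
    have h1 : HasDerivAt (fun s => b * s) b s := by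
      simpa using (hasDerivAt_id s).const_mul b
    have h2 := (HasDerivAt.comp s (h₂ := fun y => pd1 (pd1 k) (0, y))
      hks.pd1.pd1.hasDerivAt_pd2 h1).const_mul a
    have h3 : deriv (fun s => a * pd1 (pd1 k) (0, b * s)) s
      = a * (pd2 (pd1 (pd1 k)) (0, b * s) * b) := h2.deriv
    -- The derivative is `a b k_xxy = ε (D - ε k_xx²)`, and `ε² = a² = 1`.
    rw [h3, ← hs]
    have hε := hg.sq
    rw [← hab] at hε ⊢
    linear_combination (-pd1 (pd1 k) (0, b * s) ^ 2 * hε) + pd1 (pd1 k) (0, b * s) ^ 2 * ha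

/-! ### Derivatives of holomorphic extensions -/

/-- Complex partial derivative with respect to the first variable. -/
noncomputable def cpd1 (G : ℂ × ℂ → ℂ) (z : ℂ × ℂ) : ℂ := fderiv ℂ G z (1, 0)

/-- Complex partial derivative with respect to the second variable. -/
noncomputable def cpd2 (G : ℂ × ℂ → ℂ) (z : ℂ × ℂ) : ℂ := fderiv ℂ G z (0, 1)

theorem AnalyticAt.cpd1 {G : ℂ × ℂ → ℂ} {z : ℂ × ℂ} (hG : AnalyticAt ℂ G z) :
    AnalyticAt ℂ (cpd1 G) z :=
  ((ContinuousLinearMap.apply ℂ ℂ ((1 : ℂ), (0 : ℂ))).analyticAt _).comp hG.fderiv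

theorem AnalyticAt.cpd2 {G : ℂ × ℂ → ℂ} {z : ℂ × ℂ} (hG : AnalyticAt ℂ G z) :
    AnalyticAt ℂ (cpd2 G) z :=
  ((ContinuousLinearMap.apply ℂ ℂ ((0 : ℂ), (1 : ℂ))).analyticAt _).comp hG.fderiv

/-- Taking real parts shows that `k` is differentiable; then the two differentials of the same
complex valued map agree. Both the inclusion of `ℝ²` and the Wick maps occur as `L`. -/
theorem ofReal_fderiv_eq {k : ℝ × ℝ → ℝ} {G : ℂ × ℂ → ℂ} {L : ℝ × ℝ →L[ℝ] ℂ × ℂ} {c : ℂ}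
    {q : ℝ × ℝ} (hG : AnalyticAt ℂ G (L q)) (h : ∀ᶠ q' in 𝓝 q, (k q' : ℂ) = c * G (L q'))
    (v : ℝ × ℝ) : ((fderiv ℝ k q v : ℝ) : ℂ) = c * fderiv ℂ G (L q) (L v) := by
  have h1 : HasFDerivAt (fun q' => c * G (L q'))
      (c • ((fderiv ℂ G (L q)).restrictScalars ℝ).comp L) q :=
    ((hG.differentiableAt.hasFDerivAt.restrictScalars ℝ).comp q L.hasFDerivAt).const_mul c
  have h2 : HasFDerivAt (fun q' => (k q' : ℂ))
      (c • ((fderiv ℂ G (L q)).restrictScalars ℝ).comp L) q := h1.congr_of_eventuallyEq h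
  have h3 : HasFDerivAt k (Complex.reCLM.comp
      (c • ((fderiv ℂ G (L q)).restrictScalars ℝ).comp L)) q := Complex.reCLM.hasFDerivAt.comp q h2
  have h4 : HasFDerivAt (fun q' => (k q' : ℂ)) (Complex.ofRealCLM.comp (fderiv ℝ k q)) q :=
    Complex.ofRealCLM.hasFDerivAt.comp q h3.differentiableAt.hasFDerivAt
  exact congrArg (fun T : ℝ × ℝ →L[ℝ] ℂ => T v) (h4.unique h2)

/-- The real linear map `(t, x) ↦ (lam x, mu t)`. -/
noncomputable def wickMap (lam mu : ℂ) : ℝ × ℝ →L[ℝ] ℂ × ℂ :=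
  ((ContinuousLinearMap.snd ℝ ℝ ℝ).smulRight lam).prod
    ((ContinuousLinearMap.fst ℝ ℝ ℝ).smulRight mu)

theorem wickMap_apply (lam mu : ℂ) (q : ℝ × ℝ) :
    wickMap lam mu q = (lam * (q.2 : ℂ), mu * (q.1 : ℂ)) := by
  simp [wickMap, mul_comm]

theorem wickMap_zero (lam mu : ℂ) : wickMap lam mu (0, 0) = (0, 0) := by
  simp [wickMap_apply]

/-- The inclusion of `ℝ²` into `ℂ²` as a real linear map. -/
noncomputable def realToComplexProdL : ℝ × ℝ →L[ℝ] ℂ × ℂ :=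
  (Complex.ofRealCLM.comp (ContinuousLinearMap.fst ℝ ℝ ℝ)).prod
    (Complex.ofRealCLM.comp (ContinuousLinearMap.snd ℝ ℝ ℝ))

theorem realToComplexProdL_apply (q : ℝ × ℝ) : realToComplexProdL q = realToComplexProd q := rfl

theorem realToComplexProd_zero : realToComplexProd (0, 0) = (0, 0) := by
  simp [realToComplexProd]

section Transfer

variable {k : ℝ × ℝ → ℝ} {G : ℂ × ℂ → ℂ} {c lam mu : ℂ} {q : ℝ × ℝ}

theorem pd1_wick (hG : AnalyticAt ℂ G (wickMap lam mu q))
    (h : ∀ᶠ q' in 𝓝 q, (k q' : ℂ) = c * G (wickMap lam mu q')) :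
    ∀ᶠ q' in 𝓝 q, ((pd1 k q' : ℝ) : ℂ) = c * mu * cpd2 G (wickMap lam mu q') := by
  filter_upwards [h.eventually_nhds,
    ((wickMap lam mu).continuous.tendsto q).eventually hG.eventually_analyticAt] with q' h1 h2
  rw [pd1, ofReal_fderiv_eq h2 h1]
  have : wickMap lam mu (1, 0) = mu • (0, 1) := by simp [wickMap_apply]
  rw [this, map_smul, smul_eq_mul, cpd2, mul_assoc]

theorem pd2_wick (hG : AnalyticAt ℂ G (wickMap lam mu q))
    (h : ∀ᶠ q' in 𝓝 q, (k q' : ℂ) = c * G (wickMap lam mu q')) :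
    ∀ᶠ q' in 𝓝 q, ((pd2 k q' : ℝ) : ℂ) = c * lam * cpd1 G (wickMap lam mu q') := by
  filter_upwards [h.eventually_nhds,
    ((wickMap lam mu).continuous.tendsto q).eventually hG.eventually_analyticAt] with q' h1 h2
  rw [pd2, ofReal_fderiv_eq h2 h1]
  have : wickMap lam mu (0, 1) = lam • (1, 0) := by simp [wickMap_apply]
  rw [this, map_smul, smul_eq_mul, cpd1, mul_assoc]

theorem pd1_real (hG : AnalyticAt ℂ G (realToComplexProd q))
    (h : ∀ᶠ q' in 𝓝 q, G (realToComplexProd q') = (k q' : ℂ)) :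
    ∀ᶠ q' in 𝓝 q, cpd1 G (realToComplexProd q') = ((pd1 k q' : ℝ) : ℂ) := by
  filter_upwards [h.eventually_nhds,
    (continuous_realToComplexProd.tendsto q).eventually hG.eventually_analyticAt] with q' h1 h2
  have := ofReal_fderiv_eq (L := realToComplexProdL) (c := 1) h2
    (h1.mono fun r hr => by rw [one_mul, realToComplexProdL_apply, hr]) (1, 0)
  rw [pd1, this, one_mul, cpd1]
  simp [realToComplexProdL, realToComplexProd]

theorem pd2_real (hG : AnalyticAt ℂ G (realToComplexProd q))
    (h : ∀ᶠ q' in 𝓝 q, G (realToComplexProd q') = (k q' : ℂ)) :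
    ∀ᶠ q' in 𝓝 q, cpd2 G (realToComplexProd q') = ((pd2 k q' : ℝ) : ℂ) := by
  filter_upwards [h.eventually_nhds,
    (continuous_realToComplexProd.tendsto q).eventually hG.eventually_analyticAt] with q' h1 h2
  have := ofReal_fderiv_eq (L := realToComplexProdL) (c := 1) h2
    (h1.mono fun r hr => by rw [one_mul, realToComplexProdL_apply, hr]) (0, 1)
  rw [pd2, this, one_mul, cpd2]
  simp [realToComplexProdL, realToComplexProd]

end Transfer

/-- The left-hand side of the complexified zero mean curvature equation. -/
noncomputable def complexZmcExpr (G : ℂ × ℂ → ℂ) (z : ℂ × ℂ) : ℂ :=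
  (1 - cpd2 G z ^ 2) * cpd1 (cpd1 G) z + 2 * cpd1 G z * cpd2 G z * cpd2 (cpd1 G) z
    + (1 - cpd1 G z ^ 2) * cpd2 (cpd2 G) z

/-- The expression is holomorphic and restricts to `zmcExpr k` at real points, so the identity
theorem applies. -/
theorem complexZmcExpr_eventually_eq_zero {k : ℝ × ℝ → ℝ} {G : ℂ × ℂ → ℂ}
    (hG : AnalyticAt ℂ G (0, 0)) (h : ∀ᶠ q in 𝓝 (0, 0), G (realToComplexProd q) = (k q : ℂ))
    (hE : ∀ᶠ q in 𝓝 (0, 0), zmcExpr k q = 0) :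
    ∀ᶠ z in 𝓝 ((0, 0) : ℂ × ℂ), complexZmcExpr G z = 0 := by
  rw [← realToComplexProd_zero] at hG ⊢
  refine AnalyticAt.eventually_eq_zero_of_realToComplexProd (p := (0, 0)) ?_ ?_
  · exact (((analyticAt_const.sub (hG.cpd2.pow 2)).mul hG.cpd1.cpd1).add
      (((analyticAt_const.mul hG.cpd1).mul hG.cpd2).mul hG.cpd1.cpd2)).add
      ((analyticAt_const.sub (hG.cpd1.pow 2)).mul hG.cpd2.cpd2)
  · have hx := pd1_real hG h
    have hy := pd2_real hG h
    filter_upwards [hE, hx, hy, pd1_real hG.cpd1 hx, pd2_real hG.cpd1 hx, pd2_real hG.cpd2 hy]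
      with q h1 h2 h3 h4 h5 h6
    rw [complexZmcExpr, h2, h3, h4, h5, h6]
    rw [zmcExpr] at h1
    exact_mod_cast h1

/-! ### Wick rotations -/

/-- The real function `h(t, x) = c k(lam x, mu t)` on the domain `V ∋ 0`. -/
def IsWickRotation (c lam mu : ℂ) (k h : ℝ × ℝ → ℝ) (V : Set (ℝ × ℝ)) : Prop :=
  IsOpen V ∧ IsPreconnected V ∧ (0, 0) ∈ V ∧
    ∃ (Ω : Set (ℂ × ℂ)) (G : ℂ × ℂ → ℂ), IsHolomorphicExtension k Ω G ∧
      ∀ q ∈ V, wickMap lam mu q ∈ Ω ∧ (h q : ℂ) = c * G (wickMap lam mu q)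

theorem IsWickRotationEven.isWickRotation {g h : ℝ × ℝ → ℝ} {V : Set (ℝ × ℝ)}
    (hw : IsWickRotationEven g h V) : IsWickRotation 1 Complex.I 1 g h V := by
  obtain ⟨h1, h2, h3, Ω, G, hG, h4⟩ := hw
  refine ⟨h1, h2, h3, Ω, G, hG, fun q hq => ?_⟩
  have := h4 q.1 q.2 hq
  rwa [wickMap_apply, one_mul, one_mul]

/-- For `k(x, y) = g(y, x)` one has `-i g(i t, x) = -i k(x, i t)`. -/
theorem IsWickRotationOdd.isWickRotation {g h : ℝ × ℝ → ℝ} {V : Set (ℝ × ℝ)}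
    (hw : IsWickRotationOdd g h V) :
    IsWickRotation (-Complex.I) 1 Complex.I (fun q => g q.swap) h V := by
  obtain ⟨h1, h2, h3, Ω, G, ⟨hΩ, h0, hG, hGg⟩, h4⟩ := hw
  refine ⟨h1, h2, h3, Prod.swap ⁻¹' Ω, fun z => G z.swap, ⟨hΩ.preimage continuous_swap, h0, ?_, ?_⟩,
    fun q hq => ?_⟩
  · exact fun z hz => AnalyticAt.comp₂ (h := G) (f := Prod.snd) (g := Prod.fst) (hG _ hz)
      analyticAt_snd analyticAt_fst
  · exact (continuous_swap.tendsto ((0 : ℝ), (0 : ℝ))).eventually hGg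
  · have := h4 q.1 q.2 hq
    rwa [wickMap_apply, one_mul]

namespace IsWickRotation

variable {c lam mu : ℂ} {k h : ℝ × ℝ → ℝ} {V : Set (ℝ × ℝ)}

theorem analyticOnNhd (hw : IsWickRotation c lam mu k h V) : AnalyticOnNhd ℝ h V := by
  obtain ⟨hV, -, -, Ω, G, hG, hh⟩ := hw
  intro q hq
  have h1 : AnalyticAt ℝ (fun q => c * G (wickMap lam mu q)) q :=
    analyticAt_const.mul (AnalyticAt.comp (g := G) (f := wickMap lam mu)
      ((hG.2.2.1 _ (hh q hq).1).restrictScalars) ((wickMap lam mu).analyticAt q))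
  have h2 : AnalyticAt ℝ (fun q => (c * G (wickMap lam mu q)).re) q :=
    (Complex.reCLM.analyticAt _).comp h1
  refine h2.congr ?_
  filter_upwards [hV.mem_nhds hq] with q' hq'
  rw [← (hh q' hq').2, Complex.ofReal_re]

/-- The germ at the origin of a Wick rotation. -/
theorem exists_germ (hw : IsWickRotation c lam mu k h V) :
    ∃ G : ℂ × ℂ → ℂ, AnalyticAt ℂ G (0, 0) ∧
      (∀ᶠ q in 𝓝 (0, 0), G (realToComplexProd q) = (k q : ℂ)) ∧
      ∀ᶠ q in 𝓝 (0, 0), (h q : ℂ) = c * G (wickMap lam mu q) := by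
  obtain ⟨hV, -, h0, Ω, G, hG, hh⟩ := hw
  exact ⟨G, hG.2.2.1 _ hG.2.1, hG.2.2.2, Filter.eventually_of_mem (hV.mem_nhds h0)
    fun q hq => (hh q hq).2⟩

/-- The two relations give `mu = -c lam²`. By the chain rule, near the origin the Born-Infeld
expression of `h` is `c lam²` times the complexified zero mean curvature expression of `G`, which
vanishes; connectedness of `V` carries this to all of `V`. -/
theorem solvesBornInfeld (hw : IsWickRotation c lam mu k h V) (hmu : c * mu = 1)
    (hlam : (c * lam) ^ 2 = -1) (hE : ∀ᶠ q in 𝓝 (0, 0), zmcExpr k q = 0) :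
    SolvesBornInfeld h V := by
  have han := hw.analyticOnNhd
  have hBI : AnalyticOnNhd ℝ (fun p => (1 - pd1 h p ^ 2) * pd2 (pd2 h) p
      + 2 * pd1 h p * pd2 h p * pd2 (pd1 h) p - (1 + pd2 h p ^ 2) * pd1 (pd1 h) p) V := by
    intro p hp
    have hq := han p hp
    exact (((analyticAt_const.sub (hq.pd1.pow 2)).mul hq.pd2.pd2).add
      (((analyticAt_const.mul hq.pd1).mul hq.pd2).mul hq.pd1.pd2)).sub
      ((analyticAt_const.add (hq.pd2.pow 2)).mul hq.pd1.pd1)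
  obtain ⟨G, hG, hGk, hGh⟩ := hw.exists_germ
  have hcE := complexZmcExpr_eventually_eq_zero hG hGk hE
  rw [← wickMap_zero lam mu] at hG hcE
  have hcE' := ((wickMap lam mu).continuous.tendsto (0, 0)).eventually hcE
  have hx := pd2_wick hG hGh
  have ht := pd1_wick hG hGh
  have hxx := pd2_wick hG.cpd1 hx
  have htx := pd1_wick hG.cpd1 hx
  have htt := pd1_wick hG.cpd2 ht
  refine fun p hp => hBI.eqOn_of_preconnected_of_eventuallyEq (g := fun _ => 0)
    (fun _ _ => analyticAt_const) hw.2.1 hw.2.2.1 ?_ hp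
  filter_upwards [hcE', hx, ht, hxx, htx, htt,
    (han _ hw.2.2.1).eventually_analyticAt] with q h1 h2 h3 h4 h5 h6 h7
  rw [complexZmcExpr] at h1
  rw [← h7.pd1_pd2_comm]
  have hmu2 : mu = -(c * lam ^ 2) := by
    have hc : c ≠ 0 := left_ne_zero_of_mul (hmu ▸ one_ne_zero)
    refine mul_left_cancel₀ hc ?_
    linear_combination hmu + hlam
  apply Complex.ofReal_injective
  push_cast
  rw [h2, h3, h4, h5, h6]
  set X := cpd1 G (wickMap lam mu q)
  set T := cpd2 G (wickMap lam mu q)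
  set XX := cpd1 (cpd1 G) (wickMap lam mu q)
  set XT := cpd2 (cpd1 G) (wickMap lam mu q)
  set TT := cpd2 (cpd2 G) (wickMap lam mu q)
  rw [hmu]
  linear_combination c * lam ^ 2 * h1 - (1 + (c * lam * X) ^ 2) * TT * hmu2
    + X ^ 2 * TT * c * lam ^ 2 * hlam
    + 2 * X * T * XT * c * lam ^ 2 * hmu

/-- The Taylor expansion along the lightlike segment of the Wick rotation. -/
theorem eventually_line {ε D : ℝ} (hw : IsWickRotation c lam mu k h V) (hmu : c * mu = 1)
    (hg : LightlikeLineGerm k ε D) {A : ℂ → ℂ} (hA : AnalyticAt ℂ A 0)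
    (hAk : ∀ᶠ y : ℝ in 𝓝 0, A y = (pd1 (pd1 k) (0, y) : ℂ)) :
    ∀ᶠ t : ℝ in 𝓝 0, h (t, 0) = ε * t ∧ pd2 h (t, 0) = 0 ∧
      (pd2 (pd2 h) (t, 0) : ℂ) = c * lam ^ 2 * A (mu * t) := by
  obtain ⟨G, hG, hGk, hGh⟩ := hw.exists_germ
  have hline : AnalyticAt ℂ (fun w : ℂ => ((0 : ℂ), w)) (0 : ℝ) :=
    analyticAt_const.prod analyticAt_id
  have hres : ∀ {F : ℂ × ℂ → ℂ}, AnalyticAt ℂ F (0, 0) →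
      AnalyticAt ℂ (fun w => F (0, w)) (0 : ℝ) := fun {F} hF =>
    AnalyticAt.comp (g := F) (f := fun w : ℂ => ((0 : ℂ), w))
      (by simpa using hF) hline
  have hG' : AnalyticAt ℂ G (realToComplexProd (0, 0)) := by rwa [realToComplexProd_zero]
  have hGw : AnalyticAt ℂ G (wickMap lam mu (0, 0)) := by rwa [wickMap_zero]
  have hid : AnalyticAt ℂ (fun w : ℂ => w) (0 : ℝ) := analyticAt_id
  have hx := pd1_real hG' hGk
  have hxx := pd1_real hG'.cpd1 hx
  -- The expansion of `G` along the axis to second order is known for real `y`. It extends to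
  -- complex `w`, so that it can be evaluated at `w = mu t`.
  have e0 : ∀ᶠ w in 𝓝 (0 : ℂ), G (0, w) - ε * w = 0 := by
    have := AnalyticAt.eventually_eq_zero_of_ofReal (x := 0) (f := fun w => G (0, w) - ε * w)
      ((hres hG).sub (analyticAt_const.mul hid)) (by
        filter_upwards [hg.line, tendsto_mk_zero_left.eventually hGk] with y h1 h2
        rw [realToComplexProd, h1, Complex.ofReal_zero] at h2
        rw [h2]; push_cast; ring)
    simpa using this
  have e1 : ∀ᶠ w in 𝓝 (0 : ℂ), cpd1 G (0, w) = 0 := by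
    have := AnalyticAt.eventually_eq_zero_of_ofReal (x := 0) (f := fun w => cpd1 G (0, w))
      (hres hG.cpd1) (by
        filter_upwards [hg.tangent, tendsto_mk_zero_left.eventually hx] with y h1 h2
        rw [realToComplexProd, h1, Complex.ofReal_zero] at h2
        exact h2)
    simpa using this
  have e2 : ∀ᶠ w in 𝓝 (0 : ℂ), cpd1 (cpd1 G) (0, w) - A w = 0 := by
    have := AnalyticAt.eventually_eq_zero_of_ofReal (x := 0)
      (f := fun w => cpd1 (cpd1 G) (0, w) - A w)
      ((hres hG.cpd1.cpd1).sub (by simpa using hA)) (by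
        filter_upwards [hAk, tendsto_mk_zero_left.eventually hxx] with y h1 h2
        rw [realToComplexProd, Complex.ofReal_zero] at h2
        rw [h2, h1, sub_self])
    simpa using this
  have hmul : Filter.Tendsto (fun t : ℝ => mu * (t : ℂ)) (𝓝 0) (𝓝 0) := by
    have : Continuous fun t : ℝ => mu * (t : ℂ) := by fun_prop
    simpa using this.tendsto 0
  have hX := pd2_wick hGw hGh
  have hXX := pd2_wick hGw.cpd1 hX
  filter_upwards [hmul.eventually e0, hmul.eventually e1, hmul.eventually e2,
    tendsto_mk_zero_right.eventually hGh, tendsto_mk_zero_right.eventually hX,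
    tendsto_mk_zero_right.eventually hXX] with t h0 h1 h2 h3 h4 h5
  simp only [wickMap_apply, Complex.ofReal_zero, mul_zero] at h3 h4 h5
  refine ⟨?_, ?_, ?_⟩
  · apply Complex.ofReal_injective
    rw [h3, sub_eq_zero.1 h0]
    push_cast
    linear_combination ε * t * hmu
  · apply Complex.ofReal_injective
    rw [h4, h1, mul_zero, Complex.ofReal_zero]
  · rw [h5, sub_eq_zero.1 h2]; ring

/-- The approximation function of a Wick rotation along its lightlike segment. -/
theorem hasApproximationFunction {ε D a b : ℝ} {J : Set ℝ}
    (hw : IsWickRotation c lam mu k h V) (hmu : c * mu = 1)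
    (hg : LightlikeLineGerm k ε D) {A : ℂ → ℂ} (hA : AnalyticAt ℂ A 0)
    (hAk : ∀ᶠ s : ℝ in 𝓝 0, A s = ((a * pd1 (pd1 k) (0, b * s) : ℝ) : ℂ))
    (ha : a * a = 1) (hb : b * b = 1) (hab : a * b = ε)
    (hJ : IsOpenIntervalAtZero J) (hJV : ∀ s ∈ J, (b * s, 0) ∈ V) :
    HasApproximationFunction (reflectTY b a (graphOverTX h V)) J
        (fun s => -a * pd2 (pd2 h) (b * s, 0)) ∧
      AnalyticOnNhd ℝ (fun s => -a * pd2 (pd2 h) (b * s, 0)) J ∧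
      ∀ᶠ s : ℝ in 𝓝 0, ((-a * pd2 (pd2 h) (b * s, 0) : ℝ) : ℂ)
        = -(c * lam ^ 2) * A (mu * s) := by
  have han := hw.analyticOnNhd
  have haC : (a : ℂ) * a = 1 := by exact_mod_cast ha
  have hbC : (b : ℂ) * b = 1 := by exact_mod_cast hb
  -- Since `a² = b² = 1`, the function `a A(b w)` undoes the normalization and extends `k_xx(0, ·)`
  -- itself.
  have hev := (tendsto_const_mul_zero b).eventually (hw.eventually_line hmu hg
    (A := fun w => a * A (b * w))
    (analyticAt_const.mul (AnalyticAt.comp (g := A) (f := fun w : ℂ => (b : ℂ) * w)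
      (by simpa using hA) (analyticAt_const.mul analyticAt_id)))
    (by
      filter_upwards [(tendsto_const_mul_zero b).eventually hAk] with y hy
      push_cast at hy
      rw [hy, ← mul_assoc b b, hb, one_mul, ← mul_assoc, haC, one_mul]))
  have hres : ∀ {f : ℝ × ℝ → ℝ}, AnalyticOnNhd ℝ f V → AnalyticOnNhd ℝ (fun s => f (b * s, 0)) J :=
    fun {f} hf s hs => AnalyticAt.comp₂ (h := f) (f := fun s : ℝ => b * s)
      (g := fun _ : ℝ => (0 : ℝ)) (hf _ (hJV s hs)) (analyticAt_const.mul analyticAt_id)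
      analyticAt_const
  refine ⟨hasApproximationFunction_graphOverTX hw.1 han hJ.1 ha hJV ?_ ?_, ?_, ?_⟩
  · refine hJ.eqOn (hres han) (fun s _ => analyticAt_const.mul analyticAt_id) ?_
    filter_upwards [hev] with s hs
    rw [hs.1, ← hab]
    linear_combination a * s * hb
  · exact hJ.eqOn (hres fun p hp => (han p hp).pd2) (fun s _ => analyticAt_const)
      (hev.mono fun _ h => h.2.1)
  · exact fun s hs => analyticAt_const.mul (hres (fun p hp => (han p hp).pd2.pd2) s hs)
  · filter_upwards [hev] with s hs
    have e : (b : ℂ) * (mu * ((b * s : ℝ) : ℂ)) = mu * s := by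
      push_cast; linear_combination mu * s * hbC
    rw [Complex.ofReal_mul, hs.2.2, e, Complex.ofReal_neg]
    linear_combination -(c * lam ^ 2 * A (mu * s)) * haC

end IsWickRotation

/-! ### Holomorphic extension along an interval -/

/-- Regard `α` as a function on `ℝ²` independent of the first variable, complexify, and restrict to
first coordinate zero. -/
theorem exists_complexification_of_interval {J : Set ℝ} {α : ℝ → ℝ} (hα : AnalyticOnNhd ℝ α J) :
    ∃ (D : Set ℂ) (A : ℂ → ℂ), IsOpen D ∧ AnalyticOnNhd ℂ A D ∧
      ∀ s ∈ J, (s : ℂ) ∈ D ∧ A (s : ℂ) = (α s : ℂ) := by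
  have hf : AnalyticOnNhd ℝ (fun q : ℝ × ℝ => α q.2) {q | q.2 ∈ J} := fun q hq =>
    AnalyticAt.comp (g := α) (hα q.2 hq) analyticAt_snd
  obtain ⟨Ω, G, hΩ, hG, hGf⟩ := hf.exists_complexification
  refine ⟨{w | ((0 : ℂ), w) ∈ Ω}, fun w => G (0, w),
    hΩ.preimage (Continuous.prodMk_right (0 : ℂ)), fun w hw => ?_, fun s hs => ?_⟩
  · exact AnalyticAt.comp₂ (h := G) (f := fun _ : ℂ => (0 : ℂ)) (g := fun w => w) (hG _ hw)
      analyticAt_const analyticAt_id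
  · obtain ⟨h1, h2, -⟩ := hGf (0, s) hs
    have h3 := h2.self_of_nhds
    rw [realToComplexProd, Complex.ofReal_zero] at h1 h3
    exact ⟨h1, h3⟩

/-! ### Existence of Wick rotations -/

theorem eventually_parity {g : ℝ × ℝ → ℝ} {G : ℂ × ℂ → ℂ} {y : ℝ} {σ : ℝ}
    (hG : AnalyticAt ℂ G (realToComplexProd (0, y)))
    (hGg : ∀ᶠ q in 𝓝 (0, y), G (realToComplexProd q) = (g q : ℂ))
    (hg : ∀ᶠ q : ℝ × ℝ in 𝓝 (0, y), g (-q.1, q.2) = σ * g q) :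
    ∀ᶠ z in 𝓝 (realToComplexProd (0, y)), G (-z.1, z.2) = σ * G z := by
  have hfix : (-(realToComplexProd (0, y)).1, (realToComplexProd (0, y)).2)
      = realToComplexProd (0, y) := by simp [realToComplexProd]
  have hG' : AnalyticAt ℂ (fun z : ℂ × ℂ => G (-z.1, z.2)) (realToComplexProd (0, y)) :=
    AnalyticAt.comp₂ (h := G) (f := fun z : ℂ × ℂ => -z.1) (g := fun z => z.2)
      (by rwa [hfix]) analyticAt_fst.neg analyticAt_snd
  have hneg : Filter.Tendsto (fun q : ℝ × ℝ => (-q.1, q.2)) (𝓝 (0, y)) (𝓝 (0, y)) := by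
    have : Continuous fun q : ℝ × ℝ => (-q.1, q.2) := by fun_prop
    simpa using this.tendsto (0, y)
  have := AnalyticAt.eventually_eq_zero_of_realToComplexProd
    (F := fun z => G (-z.1, z.2) - σ * G z) (hG'.sub (analyticAt_const.mul hG)) (by
      filter_upwards [hGg, hneg.eventually hGg, hg] with q h1 h2 h3
      have e : realToComplexProd (-q.1, q.2)
        = (-(realToComplexProd q).1, (realToComplexProd q).2) := by simp [realToComplexProd]
      rw [← e, h1, h2, h3]
      push_cast; ring)
  exact this.mono fun z hz => sub_eq_zero.1 hz

theorem eventually_mem_reflect {U : Set (ℝ × ℝ)} (hU : IsOpen U) {y : ℝ} (hy : (0, y) ∈ U) :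
    ∀ᶠ q : ℝ × ℝ in 𝓝 (0, y), q ∈ U ∧ (-q.1, q.2) ∈ U := by
  have hneg : Continuous fun q : ℝ × ℝ => (-q.1, q.2) := by fun_prop
  exact (hU.eventually_mem hy).and ((hU.preimage hneg).eventually_mem (by simpa using hy))

/-- Near the axis `G` is even in its first variable and commutes with conjugation. As `(i x, t)` has
conjugate `(-i x, t)`, the value `G(i x, t)` is its own conjugate. -/
theorem exists_isWickRotationEven {g : ℝ × ℝ → ℝ} {U : Set (ℝ × ℝ)} {J : Set ℝ}
    (hU : IsOpen U) (hg : AnalyticOnNhd ℝ g U) (heven : EvenInFirst g U)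
    (hJ : IsOpenIntervalAtZero J) (hJU : ∀ y ∈ J, (0, y) ∈ U) :
    ∃ (V : Set (ℝ × ℝ)) (h : ℝ × ℝ → ℝ), IsWickRotationEven g h V ∧ ∀ t ∈ J, (t, 0) ∈ V := by
  obtain ⟨Ω, G, hΩ, hG, hGg⟩ := hg.exists_complexification
  have hloc : ∀ y ∈ J, ∃ ρ > 0, ∀ z ∈ Metric.ball (realToComplexProd (0, y)) ρ,
      z ∈ Ω ∧ G (-z.1, z.2) = G z ∧ G (conjProd z) = starRingEnd ℂ (G z) := by
    intro y hy
    obtain ⟨h1, h2, h3⟩ := hGg _ (hJU y hy)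
    have hpar := eventually_parity (σ := 1) (hG _ h1) h2 (by
      filter_upwards [eventually_mem_reflect hU (hJU y hy)] with q hq
      rw [one_mul, heven q.1 q.2 hq.1 hq.2])
    obtain ⟨ρ, hρ, hb⟩ := Metric.eventually_nhds_iff_ball.1
      (((hΩ.eventually_mem h1).and hpar).and h3)
    exact ⟨ρ, hρ, fun z hz => ⟨(hb z hz).1.1, by simpa using (hb z hz).1.2, (hb z hz).2⟩⟩
  choose! ρ hρ hb using hloc
  have hmem : ∀ (y : ℝ) (r : ℝ) (q : ℝ × ℝ), q ∈ Metric.ball (y, (0 : ℝ)) r →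
      (Complex.I * (q.2 : ℂ), (q.1 : ℂ)) ∈ Metric.ball (realToComplexProd (0, y)) r := by
    intro y r q hq
    rw [← ball_prod_same] at hq
    rw [realToComplexProd, ← ball_prod_same]
    refine ⟨?_, ?_⟩
    · simpa [Complex.dist_eq, Real.dist_eq] using hq.2
    · have := hq.1
      rw [Metric.mem_ball, Real.dist_eq] at this
      rw [Metric.mem_ball, Complex.dist_eq, ← Complex.ofReal_sub, Complex.norm_real]
      exact this
  set V : Set (ℝ × ℝ) := ⋃ y ∈ J, Metric.ball (y, (0 : ℝ)) (ρ y) with hV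
  have hsub : ∀ y ∈ J, Metric.ball (y, (0 : ℝ)) (ρ y) ⊆ V := fun y hy =>
    Set.subset_biUnion_of_mem (u := fun y => Metric.ball (y, (0 : ℝ)) (ρ y)) hy
  have hJV : ∀ t ∈ J, (t, 0) ∈ V := fun t ht => hsub t ht (Metric.mem_ball_self (hρ t ht))
  refine ⟨V, fun q => (G (Complex.I * (q.2 : ℂ), (q.1 : ℂ))).re,
    ⟨isOpen_biUnion fun _ _ => Metric.isOpen_ball, ?_, hJV 0 hJ.2.2, Ω, G,
      ⟨hΩ, ?_, hG, (hGg _ (hJU 0 hJ.2.2)).2.1⟩, ?_⟩, hJV⟩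
  -- Each ball is centred on the connected set `J × {0}`, which joins it to the origin.
  · have hK : IsPreconnected ((fun t : ℝ => (t, (0 : ℝ))) '' J) :=
      hJ.isPreconnected.image _ (Continuous.prodMk_left (0 : ℝ)).continuousOn
    refine isPreconnected_of_forall (0, 0) fun q hq => ?_
    obtain ⟨y, hy, hqy⟩ : ∃ y ∈ J, q ∈ Metric.ball (y, (0 : ℝ)) (ρ y) := by
      simpa [hV] using hq
    refine ⟨(fun t : ℝ => (t, (0 : ℝ))) '' J ∪ Metric.ball (y, 0) (ρ y),
      Set.union_subset ?_ (hsub y hy), Or.inl ⟨0, hJ.2.2, rfl⟩, Or.inr hqy,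
      IsPreconnected.union (y, 0) ⟨y, hy, rfl⟩ (Metric.mem_ball_self (hρ y hy)) hK
        (convex_ball _ _).isPreconnected⟩
    rintro _ ⟨t, ht, rfl⟩
    exact hJV t ht
  · rw [← realToComplexProd_zero]; exact (hGg _ (hJU 0 hJ.2.2)).1
  · intro t x hq
    obtain ⟨y, hy, hqy⟩ : ∃ y ∈ J, (t, x) ∈ Metric.ball (y, (0 : ℝ)) (ρ y) := by
      simpa [hV] using hq
    obtain ⟨h1, h2, h3⟩ := hb y hy _ (hmem y _ _ hqy)
    refine ⟨h1, Complex.conj_eq_iff_re.1 ?_⟩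
    rw [← h3, ← h2]
    simp [conjProd]

/-- Here `G` is odd in its first variable, so the same argument makes `G(i t, x)` purely imaginary;
the factor `-i` makes it real. -/
theorem exists_isWickRotationOdd {g : ℝ × ℝ → ℝ} {U : Set (ℝ × ℝ)}
    (hU : IsOpen U) (h0 : (0, 0) ∈ U) (hg : AnalyticOnNhd ℝ g U) (hodd : OddInFirst g U) :
    ∃ (V : Set (ℝ × ℝ)) (h : ℝ × ℝ → ℝ), IsWickRotationOdd g h V := by
  obtain ⟨Ω, G, hΩ, hG, hGg⟩ := hg.exists_complexification
  obtain ⟨h1, h2, h3⟩ := hGg _ h0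
  have hpar := eventually_parity (σ := -1) (hG _ h1) h2 (by
    filter_upwards [eventually_mem_reflect hU h0] with q hq
    rw [neg_one_mul, hodd q.1 q.2 hq.1 hq.2])
  obtain ⟨ρ, hρ, hb⟩ := Metric.eventually_nhds_iff_ball.1
    (((hΩ.eventually_mem h1).and hpar).and h3)
  rw [realToComplexProd_zero] at h1 hb
  refine ⟨Metric.ball (0, 0) ρ, fun q => (-Complex.I * G (Complex.I * (q.1 : ℂ), (q.2 : ℂ))).re,
    Metric.isOpen_ball, (convex_ball _ _).isPreconnected, Metric.mem_ball_self hρ, Ω, G,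
    ⟨hΩ, h1, hG, h2⟩, fun t x hq => ?_⟩
  have hmem : (Complex.I * (t : ℂ), (x : ℂ)) ∈ Metric.ball ((0, 0) : ℂ × ℂ) ρ := by
    rw [← ball_prod_same] at hq ⊢
    exact ⟨by simpa using hq.1, by simpa using hq.2⟩
  obtain ⟨⟨h4, h5⟩, h6⟩ := hb _ hmem
  refine ⟨h4, Complex.conj_eq_iff_re.1 ?_⟩
  rw [map_mul, ← h6]
  have e : conjProd (Complex.I * (t : ℂ), (x : ℂ)) = (-(Complex.I * (t : ℂ)), (x : ℂ)) := by
    simp [conjProd]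
  rw [e, h5]
  simp

/-! ### Imaginary rotations of approximation functions -/

/-- Both `A` and `-i B(-i z)`, with `B` an extension of `β`, are candidates for the extension and
agree near `0`, but their domains may also overlap elsewhere, where they need not agree. Cutting
them down to disjoint double sectors around the real and the imaginary axis, joined by a ball at
`0`, gives a consistent function. -/
theorem isImaginaryRotation_of_germ {J J' : Set ℝ} {α β : ℝ → ℝ} {D : Set ℂ} {A : ℂ → ℂ}
    (hJ : IsOpenIntervalAtZero J) (hJ' : IsOpenIntervalAtZero J') (hD : IsOpen D)
    (hA : AnalyticOnNhd ℂ A D) (hAα : ∀ s ∈ J, (s : ℂ) ∈ D ∧ A (s : ℂ) = (α s : ℂ))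
    (hβ : AnalyticOnNhd ℝ β J')
    (hβA : ∀ᶠ s : ℝ in 𝓝 0, (β s : ℂ) = Complex.I * A (Complex.I * s)) :
    IsImaginaryRotation J α J' β := by
  classical
  obtain ⟨D', B, hD', hB, hBβ⟩ := exists_complexification_of_interval hβ
  have h0D : (0 : ℂ) ∈ D := by simpa using (hAα 0 hJ.2.2).1
  have h0D' : (0 : ℂ) ∈ D' := by simpa using (hBβ 0 hJ'.2.2).1
  have hrot : AnalyticAt ℂ (fun w => A (Complex.I * w)) (0 : ℝ) :=
    AnalyticAt.comp (g := A) (f := fun w : ℂ => Complex.I * w) (hA _ (by simpa using h0D))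
      (analyticAt_const.mul analyticAt_id)
  have hgerm : ∀ᶠ w in 𝓝 (0 : ℂ), B w - Complex.I * A (Complex.I * w) = 0 := by
    have := AnalyticAt.eventually_eq_zero_of_ofReal (x := 0)
      (f := fun w => B w - Complex.I * A (Complex.I * w))
      ((hB _ (by simpa using h0D')).sub (analyticAt_const.mul hrot)) (by
        filter_upwards [hβA, hJ'.mem_nhds] with s h1 h2
        rw [(hBβ s h2).2, h1, sub_self])
    simpa using this
  obtain ⟨r, hr, hb⟩ := Metric.eventually_nhds_iff_ball.1 (hgerm.and (hD.eventually_mem h0D))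
  have hagree : ∀ z ∈ Metric.ball (0 : ℂ) r, A z = -Complex.I * B (-Complex.I * z) := by
    intro z hz
    have hz' : -Complex.I * z ∈ Metric.ball (0 : ℂ) r := by simpa using hz
    rw [sub_eq_zero.1 (hb _ hz').1]
    have e : Complex.I * (-Complex.I * z) = z := by
      linear_combination -z * Complex.I_mul_I
    rw [e]
    linear_combination A z * Complex.I_mul_I
  let S : Set ℂ := {z | |z.im| < |z.re|}
  let S' : Set ℂ := {z | |z.re| < |z.im|}
  have hS : IsOpen S := isOpen_lt (by fun_prop) (by fun_prop)
  have hS' : IsOpen S' := isOpen_lt (by fun_prop) (by fun_prop)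
  have hcont : Continuous fun z : ℂ => -Complex.I * z := by fun_prop
  let E : Set ℂ := (D ∩ S) ∪ Metric.ball 0 r
  let E' : Set ℂ := ((fun z : ℂ => -Complex.I * z) ⁻¹' D') ∩ S'
  have hE : IsOpen E := (hD.inter hS).union Metric.isOpen_ball
  have hE' : IsOpen E' := (hD'.preimage hcont).inter hS'
  let C : ℂ → ℂ := fun z => if z ∈ E then A z else -Complex.I * B (-Complex.I * z)
  have hCE : ∀ z ∈ E, C z = A z := fun z hz => if_pos hz
  have hCE' : ∀ z ∈ E', C z = -Complex.I * B (-Complex.I * z) := by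
    intro z hz
    by_cases hzE : z ∈ E
    · rw [hCE z hzE]
      rcases hzE with h | h
      · exact (lt_asymm (a := |z.im|) (b := |z.re|) h.2 hz.2).elim
      · exact hagree z h
    · exact if_neg hzE
  have h0E : (0 : ℂ) ∈ E := Or.inr (Metric.mem_ball_self hr)
  refine ⟨E ∪ E', C, hE.union hE', ?_, fun s hs => ?_, fun s hs => ?_⟩
  · rintro z (hz | hz)
    · refine AnalyticAt.congr (f := A) ?_ ?_
      · rcases hz with h | h
        · exact hA z h.1
        · exact hA z (hb z h).2
      · filter_upwards [hE.mem_nhds hz] with w hw using (hCE w hw).symm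
    · refine AnalyticAt.congr (f := fun z => -Complex.I * B (-Complex.I * z)) ?_ ?_
      · exact analyticAt_const.mul (AnalyticAt.comp (g := B) (f := fun z : ℂ => -Complex.I * z)
          (hB _ hz.1) (analyticAt_const.mul analyticAt_id))
      · filter_upwards [hE'.mem_nhds hz] with w hw using (hCE' w hw).symm
  · have hsE : (s : ℂ) ∈ E := by
      by_cases hs0 : s = 0
      · rw [hs0]; exact_mod_cast h0E
      · exact Or.inl ⟨(hAα s hs).1, by simpa [S] using hs0⟩
    exact ⟨Or.inl hsE, (hCE _ hsE).trans (hAα s hs).2⟩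
  · by_cases hs0 : s = 0
    · subst hs0
      have h := hβA.self_of_nhds
      rw [Complex.ofReal_zero, mul_zero] at h ⊢
      exact ⟨Or.inl h0E, by rw [hCE 0 h0E, h]⟩
    · have e : -Complex.I * (Complex.I * (s : ℂ)) = s := by
        linear_combination -(s : ℂ) * Complex.I_mul_I
      have hsE' : Complex.I * (s : ℂ) ∈ E' :=
        ⟨by simpa only [Set.mem_preimage, e] using (hBβ s hs).1, by simpa [S'] using hs0⟩
      refine ⟨Or.inr hsE', ?_⟩
      rw [hCE' _ hsE', e, (hBβ s hs).2]
      linear_combination (β s : ℂ) * Complex.I_mul_I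

/-- The imaginary rotation changes the sign of the constant in the Riccati equation. -/
theorem riccati_of_imaginaryRotation {α β : ℝ → ℝ} {A : ℂ → ℂ} {D : ℝ} (hA : AnalyticAt ℂ A 0)
    (hAα : ∀ᶠ s : ℝ in 𝓝 0, A s = (α s : ℂ))
    (hα : ∀ᶠ s in 𝓝 (0 : ℝ), deriv α s + α s ^ 2 = D)
    (hβ : ∀ᶠ s : ℝ in 𝓝 0, (β s : ℂ) = Complex.I * A (Complex.I * s)) :
    ∀ᶠ s in 𝓝 (0 : ℝ), deriv β s + β s ^ 2 = -D := by
  have hA' : AnalyticAt ℂ A ((0 : ℝ) : ℂ) := by simpa using hA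
  have hofReal : Filter.Tendsto (fun s : ℝ => (s : ℂ)) (𝓝 0) (𝓝 0) := by
    simpa using Complex.continuous_ofReal.tendsto 0
  have hric : ∀ᶠ z in 𝓝 (0 : ℂ), deriv A z + A z ^ 2 - D = 0 := by
    have := AnalyticAt.eventually_eq_zero_of_ofReal (x := 0)
      (f := fun z => deriv A z + A z ^ 2 - D) ((hA'.deriv.add (hA'.pow 2)).sub analyticAt_const) (by
        filter_upwards [hAα.eventually_nhds, hα, hofReal.eventually hA.eventually_analyticAt]
          with s h1 h2 h3
        have hd := h3.differentiableAt.hasDerivAt.comp_ofReal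
        have hd' : HasDerivAt (fun y : ℝ => (α y : ℂ)) (deriv A s) s :=
          hd.congr_of_eventuallyEq (h1.mono fun y hy => hy.symm)
        have hre : HasDerivAt α (deriv A s).re s := by
          have := Complex.reCLM.hasFDerivAt.comp_hasDerivAt s hd'
          exact this
        have heq : deriv A s = ((deriv α s : ℝ) : ℂ) :=
          hd'.unique hre.differentiableAt.hasDerivAt.ofReal_comp
        rw [heq, h1.self_of_nhds, ← h2]
        push_cast; ring)
    simpa using this
  have hrot : Filter.Tendsto (fun s : ℝ => Complex.I * (s : ℂ)) (𝓝 0) (𝓝 0) := by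
    have : Continuous fun s : ℝ => Complex.I * (s : ℂ) := by fun_prop
    simpa using this.tendsto 0
  filter_upwards [hβ.eventually_nhds, hrot.eventually hric,
    hrot.eventually hA.eventually_analyticAt] with s h1 h2 h3
  have hI : HasDerivAt (fun z : ℂ => Complex.I * z) Complex.I (s : ℂ) := by
    simpa using (hasDerivAt_id (s : ℂ)).const_mul Complex.I
  have hd : HasDerivAt (fun y : ℝ => Complex.I * A (Complex.I * y))
      (Complex.I * (deriv A (Complex.I * s) * Complex.I)) s :=
    ((HasDerivAt.comp (s : ℂ) (h₂ := A) h3.differentiableAt.hasDerivAt hI).const_mul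
      Complex.I).comp_ofReal
  have hd' := hd.congr_of_eventuallyEq h1
  have hre : HasDerivAt β (Complex.I * (deriv A (Complex.I * s) * Complex.I)).re s :=
    Complex.reCLM.hasFDerivAt.comp_hasDerivAt s hd'
  have heq := hd'.unique hre.differentiableAt.hasDerivAt.ofReal_comp
  apply Complex.ofReal_injective
  push_cast
  rw [← heq, h1.self_of_nhds]
  -- For `β(s) = i A(i s)` one finds `β' + β² = -(A' + A²)(i s)`.
  linear_combination -h2 + (deriv A (Complex.I * s) + A (Complex.I * s) ^ 2) * Complex.I_mul_I

/-! ### The two cases -/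

theorem SolvesZMC.eventually {k : ℝ × ℝ → ℝ} {U : Set (ℝ × ℝ)} (hk : SolvesZMC k U)
    (hU : IsOpen U) (h0 : (0, 0) ∈ U) : ∀ᶠ q in 𝓝 (0, 0), zmcExpr k q = 0 :=
  Filter.eventually_of_mem (hU.mem_nhds h0) hk

theorem EvenInFirst.pd1_zero {g : ℝ × ℝ → ℝ} {U : Set (ℝ × ℝ)} (hg : EvenInFirst g U)
    (hU : IsOpen U) (h0 : (0, 0) ∈ U) (han : AnalyticOnNhd ℝ g U) : pd1 g (0, 0) = 0 := by
  have h := pd1_scale (f := g) (k := g) (c := 1) (l := -1) (m := 1) (p := (0, 0))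
    (by simpa using han _ h0) (by
      filter_upwards [eventually_mem_reflect hU h0] with q hq
      have := hg q.1 q.2 hq.1 hq.2
      simpa using this.symm)
  norm_num at h
  linarith

theorem pd1_comp_swap (g : ℝ × ℝ → ℝ) : pd1 (fun q => g q.swap) = fun q => pd2 g q.swap := by
  funext q
  have := (ContinuousLinearEquiv.prodComm ℝ ℝ ℝ).comp_right_fderiv (f := g) (x := q)
  exact congrArg (fun T : ℝ × ℝ →L[ℝ] ℝ => T (1, 0)) this

theorem pd2_comp_swap (g : ℝ × ℝ → ℝ) : pd2 (fun q => g q.swap) = fun q => pd1 g q.swap := by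
  funext q
  have := (ContinuousLinearEquiv.prodComm ℝ ℝ ℝ).comp_right_fderiv (f := g) (x := q)
  exact congrArg (fun T : ℝ × ℝ →L[ℝ] ℝ => T (0, 1)) this

theorem AnalyticOnNhd.comp_swap {g : ℝ × ℝ → ℝ} {U : Set (ℝ × ℝ)} (hg : AnalyticOnNhd ℝ g U) :
    AnalyticOnNhd ℝ (fun q => g q.swap) (Prod.swap ⁻¹' U) := fun _ hq =>
  AnalyticAt.comp₂ (h := g) (f := Prod.snd) (g := Prod.fst) (hg _ hq) analyticAt_snd analyticAt_fst

theorem SolvesZMC.comp_swap {g : ℝ × ℝ → ℝ} {U : Set (ℝ × ℝ)} (hg : SolvesZMC g U)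
    (han : AnalyticOnNhd ℝ g U) : SolvesZMC (fun q => g q.swap) (Prod.swap ⁻¹' U) := by
  intro q hq
  simp only [pd1_comp_swap, pd2_comp_swap]
  have h := hg q.swap hq
  rw [← (han _ hq).pd1_pd2_comm] at h
  linear_combination h

theorem causalB_comp_swap (g : ℝ × ℝ → ℝ) :
    causalB (fun q => g q.swap) = fun q => causalB g q.swap := by
  funext q
  simp only [causalB, pd1_comp_swap, pd2_comp_swap]
  ring

/-- With initial value zero the sign of the Riccati constant alone decides the class, and the two
constants are opposite. -/
theorem wick_rotation_of_odd_classes {J J' : Set ℝ} {α β : ℝ → ℝ} {D : ℝ}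
    (hJ : IsOpenIntervalAtZero J) (hJ' : IsOpenIntervalAtZero J')
    (hα : AnalyticOnNhd ℝ α J) (hβ : AnalyticOnNhd ℝ β J')
    (hαD : ∀ᶠ s in 𝓝 (0 : ℝ), deriv α s + α s ^ 2 = D)
    (hβD : ∀ᶠ s in 𝓝 (0 : ℝ), deriv β s + β s ^ 2 = -D) (hα0 : α 0 = 0) (hβ0 : β 0 = 0) :
    (HasExactClass J α .plus ∧ HasExactClass J' β .minusI) ∨
      (HasExactClass J α .zeroI ∧ HasExactClass J' β .zeroI) ∨
      (HasExactClass J α .minusI ∧ HasExactClass J' β .plus) := by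
  have h1 := hasExactClass_of_riccati hJ hα hαD
  have h2 := hasExactClass_of_riccati hJ' hβ hβD
  rw [hα0] at h1
  rw [hβ0] at h2
  rcases lt_trichotomy D 0 with hD | hD | hD
  · left
    have e1 : riccatiClass 0 D = .plus := by simp [riccatiClass, hD]
    have e2 : riccatiClass 0 (-D) = .minusI := by
      simp [riccatiClass, hD, hD.ne, hD.le]
    exact ⟨e1 ▸ h1, e2 ▸ h2⟩
  · right; left
    have e1 : riccatiClass 0 D = .zeroI := by simp [riccatiClass, hD]
    have e2 : riccatiClass 0 (-D) = .zeroI := by simp [riccatiClass, hD]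
    exact ⟨e1 ▸ h1, e2 ▸ h2⟩
  · right; right
    have e1 : riccatiClass 0 D = .minusI := by
      simp [riccatiClass, hD, hD.ne', hD.le]
    have e2 : riccatiClass 0 (-D) = .plus := by simp [riccatiClass, hD]
    exact ⟨e1 ▸ h1, e2 ▸ h2⟩

theorem theorem4p5 (U : Set (ℝ × ℝ)) (g : ℝ × ℝ → ℝ)
    (hU : IsOpen U) (h0 : (0, 0) ∈ U) (hg : AnalyticOnNhd ℝ g U) (hZMC : SolvesZMC g U)
    (hg0 : g (0, 0) = 0) (hB : causalB g (0, 0) = 0)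
    (hB1 : pd1 (causalB g) (0, 0) = 0) (hB2 : pd2 (causalB g) (0, 0) = 0) :
    (EvenInFirst g U →
      (∀ J : Set ℝ, IsOpenIntervalAtZero J → (∀ y ∈ J, (0, y) ∈ U) →
        ∃ (V : Set (ℝ × ℝ)) (h : ℝ × ℝ → ℝ),
          IsWickRotationEven g h V ∧ ∀ t ∈ J, (t, 0) ∈ V) ∧
      (∀ (V : Set (ℝ × ℝ)) (h : ℝ × ℝ → ℝ), IsWickRotationEven g h V →
        AnalyticOnNhd ℝ h V ∧ SolvesBornInfeld h V) ∧
      ∃ ε ∈ ({1, -1} : Set ℝ),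
        ∀ a ∈ ({1, -1} : Set ℝ), ∀ b ∈ ({1, -1} : Set ℝ), a * b = ε →
        ∀ Jg : Set ℝ, IsOpenIntervalAtZero Jg → (∀ s ∈ Jg, (0, b * s) ∈ U) →
        ∃ αg : ℝ → ℝ, HasApproximationFunction (reflectTY a b (graphOverXY g U)) Jg αg ∧
        ∀ (V : Set (ℝ × ℝ)) (h : ℝ × ℝ → ℝ), IsWickRotationEven g h V →
        ∀ Jh : Set ℝ, IsOpenIntervalAtZero Jh → (∀ s ∈ Jh, (b * s, 0) ∈ V) →
        ∃ αh : ℝ → ℝ, HasApproximationFunction (reflectTY b a (graphOverTX h V)) Jh αh ∧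
          (∀ s ∈ Jg ∩ Jh, αh s = αg s) ∧
          ∃ T : LightlikeLineClass, HasExactClass Jg αg T ∧ HasExactClass Jh αh T) ∧
    (OddInFirst g U →
      (∃ (V : Set (ℝ × ℝ)) (h : ℝ × ℝ → ℝ), IsWickRotationOdd g h V) ∧
      (∀ (V : Set (ℝ × ℝ)) (h : ℝ × ℝ → ℝ), IsWickRotationOdd g h V →
        AnalyticOnNhd ℝ h V ∧ SolvesBornInfeld h V) ∧
      ∃ ε ∈ ({1, -1} : Set ℝ),
        ∀ a ∈ ({1, -1} : Set ℝ), ∀ b ∈ ({1, -1} : Set ℝ), a * b = ε →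
        ∀ Jg : Set ℝ, IsOpenIntervalAtZero Jg → (∀ s ∈ Jg, (b * s, 0) ∈ U) →
        ∃ αg : ℝ → ℝ,
          HasApproximationFunction (reflectTY a b (swapXY (graphOverXY g U))) Jg αg ∧
        ∀ (V : Set (ℝ × ℝ)) (h : ℝ × ℝ → ℝ), IsWickRotationOdd g h V →
        ∀ Jh : Set ℝ, IsOpenIntervalAtZero Jh → (∀ s ∈ Jh, (b * s, 0) ∈ V) →
        ∃ αh : ℝ → ℝ, HasApproximationFunction (reflectTY b a (graphOverTX h V)) Jh αh ∧
          IsImaginaryRotation Jg αg Jh αh ∧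
          (∀ s ∈ Jg, -s ∈ Jg → αg (-s) = -αg s) ∧
          (∀ s ∈ Jh, -s ∈ Jh → αh (-s) = -αh s) ∧
          ((HasExactClass Jg αg .plus ∧ HasExactClass Jh αh .minusI) ∨
           (HasExactClass Jg αg .zeroI ∧ HasExactClass Jh αh .zeroI) ∨
           (HasExactClass Jg αg .minusI ∧ HasExactClass Jh αh .plus))) := by
  refine ⟨fun heven => ⟨fun J hJ hJU => exists_isWickRotationEven hU hg heven hJ hJU,
    fun V h hw => ?_, ?_⟩, fun hodd => ⟨exists_isWickRotationOdd hU h0 hg hodd,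
    fun V h hw => ?_, ?_⟩⟩
  · exact ⟨hw.isWickRotation.analyticOnNhd, hw.isWickRotation.solvesBornInfeld (by simp) (by simp)
      (hZMC.eventually hU h0)⟩
  · obtain ⟨ε, hε, D, hgerm⟩ := exists_lightlikeLineGerm (hg _ h0) (hZMC.eventually hU h0) hg0
      hB hB1
      (heven.pd1_zero hU h0 hg)
    refine ⟨ε, hε, fun a ha b hb hab Jg hJg hJgU => ?_⟩
    have ha1 := mul_self_of_mem_signs ha
    have hb1 := mul_self_of_mem_signs hb
    obtain ⟨happ, han, hric⟩ := hgerm.hasApproximationFunction hU hg ha1 hb1 hab hJg hJgU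
    refine ⟨_, happ, fun V h hw Jh hJh hJhV => ?_⟩
    obtain ⟨E, A, -, hA, hAα⟩ := exists_complexification_of_interval han
    have hA0 : AnalyticAt ℂ A 0 := by simpa using hA _ (hAα 0 hJg.2.2).1
    obtain ⟨happ', han', hev⟩ := hw.isWickRotation.hasApproximationFunction (by simp) hgerm hA0
      (Filter.eventually_of_mem hJg.mem_nhds fun s hs => (hAα s hs).2) ha1 hb1 hab hJh hJhV
    -- Here `c = mu = 1` and `lam = i`, so the factor `-c lam²` is `1` and the two germs coincide.
    have heq : (fun s => -a * pd2 (pd2 h) (b * s, 0))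
        =ᶠ[𝓝 0] fun s => a * pd1 (pd1 g) (0, b * s) := by
      filter_upwards [hev, hJg.mem_nhds] with s h1 h2
      apply Complex.ofReal_injective
      rw [h1, one_mul, one_mul, (hAα s h2).2]
      simp
    refine ⟨_, happ', (hJg.inter hJh).eqOn (fun s hs => han' s hs.2) (fun s hs => han s hs.1) heq,
      _, hasExactClass_of_riccati hJg han hric, ?_⟩
    have hric' : ∀ᶠ s in 𝓝 (0 : ℝ), deriv (fun s => -a * pd2 (pd2 h) (b * s, 0)) s
        + (-a * pd2 (pd2 h) (b * s, 0)) ^ 2 = ε * D := by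
      filter_upwards [hric, heq.eventuallyEq_nhds] with s h1 h2
      have h3 : -a * pd2 (pd2 h) (b * s, 0) = a * pd1 (pd1 g) (0, b * s) := h2.self_of_nhds
      rw [h2.deriv_eq, h3, h1]
    have hc := hasExactClass_of_riccati hJh han' hric'
    have h3 : -a * pd2 (pd2 h) (b * 0, 0) = a * pd1 (pd1 g) (0, b * 0) := heq.self_of_nhds
    rwa [h3] at hc
  · have hZMC' := (hZMC.comp_swap hg).eventually (hU.preimage continuous_swap) h0
    exact ⟨hw.isWickRotation.analyticOnNhd, hw.isWickRotation.solvesBornInfeld (by simp) (by simp)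
      hZMC'⟩
  · have hU' : IsOpen (Prod.swap ⁻¹' U) := hU.preimage continuous_swap
    have hk := hg.comp_swap
    -- After the exchange the function is odd in its second variable `y`, and so are its
    -- `x`-derivatives. This yields `k_x = 0` at the origin and the oddness of `α_g`.
    have hodd' : ∀ᶠ q : ℝ × ℝ in 𝓝 (0, 0), g q.swap = -1 * g (1 * q.1, -1 * q.2).swap := by
      filter_upwards [(continuous_swap.tendsto ((0 : ℝ), (0 : ℝ))).eventually
        (eventually_mem_reflect hU h0)] with q hq
      have := hodd q.2 q.1 hq.1 hq.2
      simp only [one_mul, neg_one_mul, Prod.swap_prod_mk, this, neg_neg]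
      rfl
    have hk0 : AnalyticAt ℝ (fun q => g q.swap) (0, 0) := hk (0, 0) h0
    have hodd1 := pd1_scale_eventually (k := fun q => g q.swap) (by simpa using hk0) hodd'
    have hodd2 := pd1_scale_eventually (by simpa using hk0.pd1) hodd1
    have hQ0 : pd1 (fun q => g q.swap) (0, 0) = 0 := by
      have := hodd1.self_of_nhds
      norm_num at this
      linarith
    obtain ⟨ε, hε, D, hgerm⟩ := exists_lightlikeLineGerm hk0
      ((hZMC.comp_swap hg).eventually hU' h0) hg0 (by rw [causalB_comp_swap]; exact hB)
      (by rw [causalB_comp_swap, pd1_comp_swap]; exact hB2) hQ0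
    refine ⟨ε, hε, fun a ha b hb hab Jg hJg hJgU => ?_⟩
    have ha1 := mul_self_of_mem_signs ha
    have hb1 := mul_self_of_mem_signs hb
    obtain ⟨happ, han, hric⟩ := hgerm.hasApproximationFunction hU' hk ha1 hb1 hab hJg hJgU
    refine ⟨_, happ, fun V h hw Jh hJh hJhV => ?_⟩
    obtain ⟨E, A, hE, hA, hAα⟩ := exists_complexification_of_interval han
    have hA0 : AnalyticAt ℂ A 0 := by simpa using hA _ (hAα 0 hJg.2.2).1
    have hAev := Filter.eventually_of_mem hJg.mem_nhds fun s hs => (hAα s hs).2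
    obtain ⟨happ', han', hev⟩ := hw.isWickRotation.hasApproximationFunction (by simp) hgerm hA0
      hAev ha1 hb1 hab hJh hJhV
    -- Here `c = mu⁻¹ = -i` and `lam = 1`, so `-c lam² = i`.
    have hev' : ∀ᶠ s : ℝ in 𝓝 0, ((-a * pd2 (pd2 h) (b * s, 0) : ℝ) : ℂ)
        = Complex.I * A (Complex.I * s) := by
      filter_upwards [hev] with s hs
      rw [hs]; ring
    have hαodd : ∀ᶠ s in 𝓝 (0 : ℝ), a * pd1 (pd1 fun q => g q.swap) (0, b * -s)
        = -(a * pd1 (pd1 fun q => g q.swap) (0, b * s)) := by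
      filter_upwards [(tendsto_const_mul_zero b).eventually
        (tendsto_mk_zero_left.eventually hodd2)] with s hs
      rw [hs, mul_zero, mul_neg, neg_one_mul]
      ring_nf
    -- Oddness passes from the real axis to the holomorphic extension, and so to the imaginary axis,
    -- where `α_h` is read off.
    have hAodd : ∀ᶠ z in 𝓝 (0 : ℂ), A (-z) + A z = 0 := by
      have h1 : AnalyticAt ℂ (fun z => A (-z)) (0 : ℝ) :=
        AnalyticAt.comp (g := A) (f := fun z : ℂ => -z) (by simpa using hA0) analyticAt_id.neg
      have h2 := AnalyticAt.eventually_eq_zero_of_ofReal (x := 0) (f := fun z => A (-z) + A z)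
        (h1.add (by simpa using hA0)) (by
          have hneg : Filter.Tendsto (fun s : ℝ => -s) (𝓝 0) (𝓝 0) := by
            simpa using (continuous_neg (G := ℝ)).tendsto 0
          filter_upwards [hαodd, hAev, hneg.eventually hAev] with s h3 h4 h5
          rw [Complex.ofReal_neg] at h5
          rw [h5, h4, h3]
          simp)
      simpa using h2
    have hβodd : ∀ᶠ s in 𝓝 (0 : ℝ), -a * pd2 (pd2 h) (b * -s, 0)
        = -(-a * pd2 (pd2 h) (b * s, 0)) := by
      have hneg : Filter.Tendsto (fun s : ℝ => -s) (𝓝 0) (𝓝 0) := by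
        simpa using (continuous_neg (G := ℝ)).tendsto 0
      have hrot : Filter.Tendsto (fun s : ℝ => Complex.I * (s : ℂ)) (𝓝 0) (𝓝 0) := by
        have : Continuous fun s : ℝ => Complex.I * (s : ℂ) := by fun_prop
        simpa using this.tendsto 0
      filter_upwards [hev', hneg.eventually hev', hrot.eventually hAodd] with s h1 h2 h3
      apply Complex.ofReal_injective
      rw [Complex.ofReal_neg (_ * _), h1, h2, Complex.ofReal_neg, mul_neg]
      linear_combination Complex.I * h3
    refine ⟨_, happ', isImaginaryRotation_of_germ hJg hJh hE hA hAα han' hev', hJg.odd han hαodd,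
      hJh.odd han' hβodd, wick_rotation_of_odd_classes hJg hJh han han' hric
        (riccati_of_imaginaryRotation hA0 hAev hric hev') ?_ ?_⟩
    · have := hαodd.self_of_nhds
      rw [neg_zero] at this
      linarith
    · have := hβodd.self_of_nhds
      rw [neg_zero] at this
      linarith
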